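/- Let $\mathbb{C}^*=\mathbb{C}\setminus\{0\}$ and $\widehat{\mathbb{C}}=\mathbb{C}\cup\{\infty\}$. Let $f:\mathbb{C}^*\to\mathbb{C}^*$ be a transcendental self-map of $\mathbb{C}^*$, that is, a holomorphic map for which both $0$ and $\infty$ are essential singularities. Its Fatou set $F(f)$ is the set of points of $\mathbb{C}^*$ that have an open neighbourhood in $\mathbb{C}^*$ on which the iterates $\{f^n\}_{n\in\mathbb{N}}$ form a normal family (as maps into $\widehat{\mathbb{C}}$ with the spherical metric), and its Julia set is $J(f)=\mathbb{C}^*\setminus F(f)$. For $E,Y,X\subset\widehat{\mathbb{C}}$ we say that $E$ separates $Y$ from $X$ if there is an open set $U\supset Y$ such that $\partial U\subset E$ and the closure of $U$ in $\widehat{\mathbb{C}}$ does not meet $X$; if $Y=\{z\}$ we say that $E$ separates $z$ from $X$. A subset of $\mathbb{C}^*$ is bounded in $\mathbb{C}^*$ if its closure in $\widehat{\mathbb{C}}$ contains neither $0$ nor $\infty$. A set $E\subset\mathbb{C}^*$ is a $\mathbb{C}^*$-spider's web if $E$ is connected and there is a sequence of domains $(G_n)_{n\in\mathbb{N}}$,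 each bounded in $\mathbb{C}^*$, such that (a) for each $n$, the domain $G_n$ is doubly connected (that is, $\widehat{\mathbb{C}}\setminus G_n$ has exactly two connected components) and separates $0$ from $\infty$; (b) $G_n\subset G_{n+1}$ and $\partial G_n\subset E$ for each $n$; (c) $\bigcup_{n} G_n=\mathbb{C}^*$. Suppose that $X\subset\mathbb{C}^*$ is forward invariant, that is, $f(X)\subset X$. Then $X$ contains a $\mathbb{C}^*$-spider's web if and only if there is a point of $J(f)$ that $X$ separates from $\{0,\infty\}$. -/

import Mathlib

open Set Filter Topology

/-- The Riemann sphere `ℂ ∪ {∞}`. -/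
abbrev Sphere : Type := OnePoint ℂ

/-- The canonical image in the Riemann sphere of a subset of the plane. -/
def toSphere (A : Set ℂ) : Set Sphere := (fun z : ℂ => (z : Sphere)) '' A

/-- The punctured plane `ℂ \ {0}`. -/
def Cstar : Set ℂ := {0}ᶜ

/-- The two points `0` and `∞` of the Riemann sphere that do not lie in the punctured plane. -/
def zeroInfty : Set Sphere := {((0 : ℂ) : Sphere), OnePoint.infty}

/-- A transcendental self-map of the punctured plane: a holomorphic map from `ℂ \ {0}` to itself
for which both `0` and `∞` are essential singularities. An isolated singularity is essential when
the function is not meromorphic there (neither a removable singularity nor a pole), and the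
singularity at `∞` is that of `w ↦ f (1 / w)` at `0`. The value `f 0` plays no role. -/
structure IsTranscendentalSelfMapCstar (f : ℂ → ℂ) : Prop where
  differentiableOn : DifferentiableOn ℂ f Cstar
  mapsTo : MapsTo f Cstar Cstar
  essential_zero : ¬ MeromorphicAt f 0
  essential_infty : ¬ MeromorphicAt (fun w : ℂ => f w⁻¹) 0

/-- A family `F` of functions into the Riemann sphere is normal on `V` if every sequence of
members of the family has a subsequence that converges locally uniformly on `V`. Uniformity refers
to the unique uniform structure of the compact Hausdorff space `Sphere`, which is the one of the
spherical (or chordal) metric; so the limit may take the value `∞`. -/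
def IsNormalFamilyOn {ι : Type*} (F : ι → ℂ → Sphere) (V : Set ℂ) : Prop :=
  letI : UniformSpace Sphere := uniformSpaceOfCompactR1
  ∀ s : ℕ → ι, ∃ φ : ℕ → ℕ, StrictMono φ ∧
    ∃ g : ℂ → Sphere, TendstoLocallyUniformlyOn (fun k : ℕ => F (s (φ k))) g atTop V

/-- The Fatou set of a self-map `f` of the punctured plane: the points that have an open
neighbourhood in `ℂ \ {0}` on which the iterates of `f` form a normal family. -/
def fatouSet (f : ℂ → ℂ) : Set ℂ :=
  {z | ∃ V : Set ℂ, IsOpen V ∧ z ∈ V ∧ V ⊆ Cstar ∧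
    IsNormalFamilyOn (fun (n : ℕ) (w : ℂ) => ((f^[n] w : ℂ) : Sphere)) V}

/-- The Julia set of a self-map `f` of the punctured plane. -/
def juliaSet (f : ℂ → ℂ) : Set ℂ := Cstar \ fatouSet f

/-- `E` separates `Y` from `X` in the Riemann sphere. -/
def Separates (E Y X : Set Sphere) : Prop :=
  ∃ U : Set Sphere, IsOpen U ∧ Y ⊆ U ∧ Disjoint (closure U) X ∧ frontier U ⊆ E

/-- A subset of the punctured plane is bounded there if its closure in the Riemann sphere contains
neither `0` nor `∞`. -/
def IsBoundedInCstar (A : Set ℂ) : Prop := Disjoint (closure (toSphere A)) zeroInfty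

/-- A domain: a non-empty connected open subset of the plane. -/
def IsDomainInPlane (G : Set ℂ) : Prop := IsOpen G ∧ IsConnected G

/-- Double connectivity of a plane domain: its complement in the Riemann sphere has exactly two
connected components. -/
def IsDoublyConnected (G : Set ℂ) : Prop :=
  Nat.card (ConnectedComponents ↥((toSphere G)ᶜ)) = 2

/-- A spider's web in the punctured plane. -/
def IsCstarSpidersWeb (E : Set ℂ) : Prop :=
  E ⊆ Cstar ∧ IsConnected E ∧
    ∃ G : ℕ → Set ℂ,
      (∀ n, IsDomainInPlane (G n) ∧ IsBoundedInCstar (G n)) ∧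
      (∀ n, IsDoublyConnected (G n) ∧
        Separates (toSphere (G n)) {((0 : ℂ) : Sphere)} {OnePoint.infty}) ∧
      (∀ n, G n ⊆ G (n + 1) ∧ frontier (G n) ⊆ E) ∧
      ⋃ n, G n = Cstar

/-! A spider's web in `X` gives a separated Julia point as soon as `J(f)` is non-empty: a Julia
point lies in some `G n`, which is bounded in the punctured plane and has its boundary in `X`.

Conversely, let `U` be a bounded neighbourhood of a Julia point with `∂U ⊆ X`. The iterates of `f`
never vanish on `U`, so by Montel's theorem their images of `U` cover the punctured plane, and
finitely many of them cover a given closed annulus. Since `f^n` is open and `X` is forward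
invariant, the boundary of this finite union lies in `X`. The component `D` of the union containing
the annulus may have many holes; only the complementary components `W ∋ 0` and `V` near infinity of
`closure D` are kept. By unicoherence of the plane `∂W` and `∂V` are connected, and the component
`G` of the complement of `closure W ∪ closure V` that contains the annulus is doubly connected with
`∂G ⊆ ∂W ∪ ∂V ⊆ X` (`exists_isAnnularFilling`).

The boundary pieces must still be joined inside `X`. As `0` is an essential singularity, `f` takes
both very small and very large values on `∂W` when `W` is small. So `f(∂W)`, a connected subset of
`X`, crosses any prescribed annular domains, and such images tie all the boundaries together
(`exists_isCstarSpidersWeb_subset`).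

The analytic input is Schottky's theorem, derived from a form of Bloch's theorem; it gives both the
Montel and the Picard theorems. That `J(f)` is non-empty is proved with an idempotent ultrafilter on
the iterates. -/

/-! ### Logarithms, arccosines and Bloch's theorem -/

section Schottky

open Metric Complex

/-- A nowhere vanishing holomorphic function on a disc has a holomorphic logarithm. -/
theorem exists_differentiableOn_exp_eq {f : ℂ → ℂ} {c : ℂ} {r : ℝ}
    (hf : DifferentiableOn ℂ f (ball c r)) (h0 : ∀ z ∈ ball c r, f z ≠ 0) :
    ∃ g : ℂ → ℂ, DifferentiableOn ℂ g (ball c r) ∧ ∀ z ∈ ball c r, exp (g z) = f z := by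
  rcases le_or_gt r 0 with hr | hr
  · exact ⟨0, by simp [ball_eq_empty.2 hr], by simp [ball_eq_empty.2 hr]⟩
  have hc : c ∈ ball c r := mem_ball_self hr
  obtain ⟨G, hG⟩ := ((hf.deriv isOpen_ball).div hf h0).isExactOn_ball
  have hfd : ∀ z ∈ ball c r, HasDerivAt f (deriv f z) z := fun z hz =>
    (hf.differentiableAt (isOpen_ball.mem_nhds hz)).hasDerivAt
  have hq : ∀ z ∈ ball c r, HasDerivAt (fun w => f w * exp (-G w)) 0 z := by
    intro z hz
    have h := (hfd z hz).mul (hG z hz).neg.cexp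
    refine HasDerivAt.congr_deriv h ?_
    have h0z := h0 z hz
    simp only [Pi.div_apply, Pi.neg_apply]
    field_simp
    ring
  have hconst : ∀ z ∈ ball c r, f z * exp (-G z) = f c * exp (-G c) := fun z hz =>
    (isOpen_ball.is_const_of_deriv_eq_zero (convex_ball c r).isPreconnected
      (fun w hw => (hq w hw).differentiableAt.differentiableWithinAt)
      (fun w hw => (hq w hw).deriv) hz hc)
  refine ⟨fun z => G z - G c + log (f c), fun z hz =>
    (((hG z hz).sub_const _).add_const _).differentiableAt.differentiableWithinAt, fun z hz => ?_⟩
  have h1 := hconst z hz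
  rw [exp_neg, exp_neg] at h1
  rw [exp_add, exp_sub, exp_log (h0 c hc)]
  field_simp [exp_ne_zero] at h1 ⊢
  linear_combination -h1

/-- Comes from `‖cos z‖ ≥ sinh |Im z|` and `sinh y ≥ y`. It controls the imaginary part of a
holomorphic arccosine by the original function. -/
theorem abs_im_le_norm_cos (z : ℂ) : |z.im| ≤ ‖cos z‖ := by
  have key : ∀ w : ℂ, 0 ≤ w.im → w.im ≤ ‖cos w‖ := by
    intro w hw
    have h1 : ‖exp (-w * I)‖ - ‖exp (w * I)‖ ≤ ‖exp (w * I) + exp (-w * I)‖ := by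
      have := norm_sub_le (exp (w * I) + exp (-w * I)) (exp (w * I))
      simp only [add_sub_cancel_left] at this
      linarith
    have h2 : ‖exp (-w * I)‖ = Real.exp w.im := by simp [norm_exp]
    have h3 : ‖exp (w * I)‖ = Real.exp (-w.im) := by simp [norm_exp]
    have h4 := Real.self_le_sinh_iff.2 hw
    rw [Real.sinh_eq] at h4
    rw [cos, norm_div, norm_ofNat]
    rw [h2, h3] at h1
    linarith
  rcases le_total 0 z.im with h | h
  · rw [abs_of_nonneg h]; exact key z h
  · rw [abs_of_nonpos h]
    simpa using key (-z) (by simpa using h)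

theorem norm_cos_le_exp_norm (z : ℂ) : ‖cos z‖ ≤ Real.exp ‖z‖ := by
  have h1 := norm_exp_le_exp_norm (z * I)
  have h2 := norm_exp_le_exp_norm (-z * I)
  have h3 := norm_add_le (exp (z * I)) (exp (-z * I))
  simp only [norm_mul, norm_neg, norm_I, mul_one] at h1 h2
  rw [cos, norm_div, norm_ofNat]
  linarith

/-- A real number is within `π` of a multiple of `2π`. -/
theorem exists_int_abs_sub_two_pi_le (x : ℝ) : ∃ k : ℤ, |x - k * (2 * Real.pi)| ≤ Real.pi := by
  have hpi := Real.pi_pos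
  refine ⟨round (x / (2 * Real.pi)), ?_⟩
  have h := abs_sub_round (x / (2 * Real.pi))
  have e : x - round (x / (2 * Real.pi)) * (2 * Real.pi) =
      (x / (2 * Real.pi) - round (x / (2 * Real.pi))) * (2 * Real.pi) := by
    field_simp
  rw [e, abs_mul, abs_of_pos (by positivity : 0 < 2 * Real.pi)]
  nlinarith

/-- A holomorphic function on a disc omitting `1` and `-1` is the cosine of a holomorphic function
whose value at the centre is controlled. -/
theorem exists_differentiableOn_cos_eq {f : ℂ → ℂ} {c : ℂ} {r : ℝ} (hr : 0 < r)
    (hf : DifferentiableOn ℂ f (ball c r)) (h1 : ∀ z ∈ ball c r, f z ≠ 1)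
    (h2 : ∀ z ∈ ball c r, f z ≠ -1) :
    ∃ F : ℂ → ℂ, DifferentiableOn ℂ F (ball c r) ∧ (∀ z ∈ ball c r, cos (F z) = f z) ∧
      ‖F c‖ ≤ Real.pi + ‖f c‖ := by
  have hc : c ∈ ball c r := mem_ball_self hr
  -- The arccosine is `-i log (f + i √(1 - f²))`: here `exp (h / 2)` is the square root, and `f + i
  -- √(1 - f²)` has the inverse `f - i √(1 - f²)`, so it never vanishes.
  obtain ⟨h, hh, hhe⟩ := exists_differentiableOn_exp_eq (f := fun z => 1 - f z ^ 2)
    ((differentiableOn_const _).sub (hf.pow 2)) (by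
      intro z hz h0
      have : (f z - 1) * (f z + 1) = 0 := by linear_combination -h0
      rcases mul_eq_zero.1 this with h | h
      · exact h1 z hz (sub_eq_zero.1 h)
      · exact h2 z hz (eq_neg_of_add_eq_zero_left h))
  have hs : ∀ z ∈ ball c r, exp (h z / 2) * exp (h z / 2) = 1 - f z ^ 2 := by
    intro z hz
    rw [← exp_add, add_halves, hhe z hz]
  have hprod : ∀ z ∈ ball c r,
      (f z + I * exp (h z / 2)) * (f z - I * exp (h z / 2)) = 1 := by
    intro z hz
    have := hs z hz
    linear_combination this - exp (h z / 2) * exp (h z / 2) * I_mul_I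
  obtain ⟨L, hL, hLe⟩ := exists_differentiableOn_exp_eq (f := fun z => f z + I * exp (h z / 2))
    (hf.add ((differentiableOn_const _).mul (hh.div_const 2).cexp))
    (fun z hz h0 => by simpa [h0] using hprod z hz)
  -- A shift by a period of the cosine brings the real part at the centre into `[-π, π]`.
  obtain ⟨k, hk⟩ := exists_int_abs_sub_two_pi_le (-I * L c).re
  have hcos : ∀ z ∈ ball c r, cos (-I * L z - k * (2 * Real.pi)) = f z := by
    intro z hz
    rw [cos_sub_int_mul_two_pi, cos]
    have e1 : -I * L z * I = L z := by linear_combination (-L z) * I_mul_I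
    have e2 : -(-I * L z) * I = -L z := by linear_combination (L z) * I_mul_I
    rw [e1, e2, exp_neg, hLe z hz]
    have := hprod z hz
    rw [inv_eq_of_mul_eq_one_right this]
    ring
  refine ⟨fun z => -I * L z - k * (2 * Real.pi), (hL.const_mul (-I)).sub_const _, hcos, ?_⟩
  refine (norm_le_abs_re_add_abs_im _).trans (add_le_add ?_ ?_)
  · have e : (-I * L c - k * (2 * Real.pi)).re = (-I * L c).re - k * (2 * Real.pi) := by
      rw [sub_re, ← ofReal_intCast, ← ofReal_ofNat, ← ofReal_mul, ← ofReal_mul, ofReal_re]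
    rw [e]
    exact hk
  · rw [← hcos c hc]
    exact abs_im_le_norm_cos _

/-- A form of Bloch's theorem. -/
theorem norm_deriv_le_of_no_unit_ball_subset_image {g : ℂ → ℂ} {c : ℂ} {R : ℝ} (hR : 0 < R)
    (hg : DifferentiableOn ℂ g (ball c R)) (h : ∀ w : ℂ, ¬ ball w 1 ⊆ g '' ball c R) :
    ‖deriv g c‖ ≤ 96 / R := by
  set ρ : ℝ := R / 2 with hρ
  have hρ0 : 0 < ρ := by positivity
  have hsub : closedBall c ρ ⊆ ball c R := closedBall_subset_ball (by linarith)
  have hgd : DifferentiableOn ℂ (deriv g) (ball c R) := hg.deriv isOpen_ball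
  -- Maximising the derivative weighted by the distance to the circle gives a point `a` such that
  -- `‖g'‖ ≤ 2 ‖g' a‖` on the disc about `a` of half the remaining distance.
  obtain ⟨a, ha, hmax⟩ := (isCompact_closedBall c ρ).exists_isMaxOn
    ⟨c, mem_closedBall_self hρ0.le⟩ (f := fun z => ‖deriv g z‖ * (ρ - dist z c))
    ((hgd.continuousOn.mono hsub).norm.mul (by fun_prop))
  have hcM : ‖deriv g c‖ * ρ ≤ ‖deriv g a‖ * (ρ - dist a c) := by
    simpa using hmax (mem_closedBall_self hρ0.le)
  suffices hM : ‖deriv g a‖ * (ρ - dist a c) ≤ 48 by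
    rw [le_div_iff₀ hR]
    nlinarith [norm_nonneg (deriv g c)]
  by_contra! hM
  set d := ‖deriv g a‖ with hd
  set t := (ρ - dist a c) / 2 with ht
  have hda : 0 < d := by
    rcases (norm_nonneg (deriv g a)).eq_or_lt' with h0 | h0
    · rw [hd, h0] at hM; norm_num at hM
    · exact h0
  have ht0 : 0 < t := by
    by_contra! h0
    nlinarith
  have hballa : ball a t ⊆ closedBall c ρ := by
    intro z hz
    rw [mem_ball] at hz
    rw [mem_closedBall]
    linarith [dist_triangle z a c]
  have hdz : ∀ z ∈ ball a t, ‖deriv g z‖ ≤ 2 * d := by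
    intro z hz
    have h1 := hmax (hballa hz)
    simp only [mem_ofPred_eq] at h1
    rw [mem_ball] at hz
    have h2 : t ≤ ρ - dist z c := by linarith [dist_triangle z a c]
    have h3 : ‖deriv g z‖ * t ≤ ‖deriv g z‖ * (ρ - dist z c) :=
      mul_le_mul_of_nonneg_left h2 (norm_nonneg _)
    have h4 : ‖deriv g z‖ * t ≤ 2 * d * t := by
      have : d * (ρ - dist a c) = 2 * d * t := by rw [ht]; ring
      linarith
    exact le_of_mul_le_mul_right h4 ht0
  have hsch : ∀ z ∈ ball a t, dist (deriv g z) (deriv g a) ≤ 3 * d / t * dist z a := by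
    intro z hz
    refine dist_le_div_mul_dist_of_mapsTo_ball (hgd.mono (hballa.trans hsub)) ?_ hz
    intro w hw
    rw [mem_closedBall, dist_eq_norm]
    linarith [norm_sub_le (deriv g w) (deriv g a), hdz w hw]
  -- By the Schwarz estimate, `g'` varies by at most `d / 2` on the disc of radius `t / 6`. Hence
  -- `‖g z - g a‖ ≥ d s / 2 = d t / 12` on its boundary, and the image contains a disc of radius `d
  -- t / 24`, which exceeds `1` because `2 d t > 48`.
  set s := t / 6 with hs
  have hs0 : 0 < s := by positivity
  have hst : closedBall a s ⊆ ball a t := closedBall_subset_ball (by rw [hs]; linarith)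
  have hsR : closedBall a s ⊆ ball c R := hst.trans (hballa.trans hsub)
  have hgA : ∀ z ∈ closedBall a s, DifferentiableAt ℂ g z := fun z hz =>
    hg.differentiableAt (isOpen_ball.mem_nhds (hsR hz))
  have hlow : ∀ z ∈ sphere a s, d * t / 12 ≤ ‖g z - g a‖ := by
    intro z hz
    have hA : ∀ w ∈ closedBall a s,
        HasDerivAt (fun w => g w - deriv g a * w) (deriv g w - deriv g a) w := by
      intro w hw
      exact ((hgA w hw).hasDerivAt.sub ((hasDerivAt_id w).const_mul (deriv g a))).congr_deriv
        (by simp)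
    have h1 := (convex_closedBall a s).norm_image_sub_le_of_norm_deriv_le
      (f := fun w => g w - deriv g a * w) (C := d / 2)
      (fun w hw => (hA w hw).differentiableAt) (fun w hw => by
        rw [(hA w hw).deriv, ← dist_eq_norm]
        refine (hsch w (hst hw)).trans ?_
        have : 3 * d / t * dist w a ≤ 3 * d / t * s :=
          mul_le_mul_of_nonneg_left (mem_closedBall.1 hw) (by positivity)
        refine this.trans (le_of_eq ?_)
        rw [hs]; field_simp; ring)
      (mem_closedBall_self hs0.le) (sphere_subset_closedBall hz)
    have hza : ‖z - a‖ = s := by simpa [dist_eq_norm] using hz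
    rw [hza] at h1
    have h2 : g z - deriv g a * z - (g a - deriv g a * a) = (g z - g a) - deriv g a * (z - a) := by
      ring
    simp only [h2] at h1
    have h3 : ‖deriv g a * (z - a)‖ = d * s := by rw [norm_mul, hza]
    have h4 := norm_sub_norm_le (deriv g a * (z - a)) (g z - g a)
    rw [norm_sub_rev (deriv g a * (z - a))] at h4
    have h5 : d * t / 12 = d * s - d / 2 * s := by rw [hs]; ring
    linarith
  have himg := DiffContOnCl.ball_subset_image_closedBall
    (f := g) (z₀ := a) (r := s) (ε := d * t / 12)
    (DifferentiableOn.diffContOnCl (by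
      rw [closure_ball a hs0.ne']; exact hg.mono hsR)) hs0 hlow (by
      by_contra hcon
      rw [not_frequently] at hcon
      have : g =ᶠ[𝓝 a] fun _ => g a := hcon.mono fun z hz => not_not.1 hz
      have h0 : deriv g a = 0 := by rw [this.deriv_eq]; simp
      rw [hd, h0] at hda
      simp at hda)
  refine h (g a) (((ball_subset_ball ?_).trans himg).trans (image_mono hsR))
  rw [ht]
  nlinarith

end Schottky

/-! ### Schottky's theorem and normality tests -/

section Montel

open Metric Complex

/-- The points where the cosine takes integer values are relatively dense in the plane. -/
theorem exists_cos_eq_int_mem_ball (z : ℂ) : ∃ w ∈ ball z 6, ∃ n : ℤ, cos w = n := by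
  obtain ⟨k, hk⟩ := exists_int_abs_sub_two_pi_le z.re
  set y := |z.im| with hy
  have hy0 : 0 ≤ y := abs_nonneg _
  -- On `[y, y + 2]` the hyperbolic cosine increases by at least `1`, so it takes an integer value
  -- there. With `cos (i v + 2πk) = cosh v` the point is found at distance at most `π + 2 < 6`.
  have hgrow : Real.cosh y + 1 ≤ Real.cosh (y + 2) := by
    have h1 := Real.one_le_cosh y
    have h2 : 2 ≤ Real.cosh 2 := by
      have h3 : (1 + 1 : ℝ) ≤ Real.exp 1 := Real.add_one_le_exp 1
      have h4 : Real.exp 2 = Real.exp 1 * Real.exp 1 := by rw [← Real.exp_add]; norm_num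
      have h5 := Real.exp_pos (-2)
      rw [Real.cosh_eq]
      nlinarith
    have h3 : 0 ≤ Real.sinh y * Real.sinh 2 :=
      mul_nonneg (Real.sinh_nonneg_iff.2 hy0) (Real.sinh_nonneg_iff.2 (by norm_num))
    rw [Real.cosh_add]
    nlinarith
  obtain ⟨t, ht, hte⟩ := intermediate_value_Icc (by linarith : y ≤ y + 2)
    Real.continuous_cosh.continuousOn
    (⟨Int.le_ceil _, (Int.ceil_lt_add_one _).le.trans hgrow⟩ :
      ((⌈Real.cosh y⌉ : ℤ) : ℝ) ∈ Icc (Real.cosh y) (Real.cosh (y + 2)))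
  obtain ⟨v, hv, hvc⟩ : ∃ v : ℝ, |z.im - v| ≤ 2 ∧ Real.cosh v = ⌈Real.cosh y⌉ := by
    rcases le_total 0 z.im with h | h
    · rw [abs_of_nonneg h] at hy
      exact ⟨t, by rw [abs_le]; constructor <;> linarith [ht.1, ht.2], hte⟩
    · rw [abs_of_nonpos h] at hy
      exact ⟨-t, by rw [abs_le]; constructor <;> linarith [ht.1, ht.2], by rw [Real.cosh_neg, hte]⟩
  refine ⟨v * I + k * (2 * Real.pi), ?_, ⌈Real.cosh y⌉, ?_⟩
  · rw [mem_ball, dist_comm, dist_eq_norm]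
    refine (norm_le_abs_re_add_abs_im _).trans_lt ?_
    have e1 : (z - (v * I + k * (2 * Real.pi))).re = z.re - k * (2 * Real.pi) := by simp
    have e2 : (z - (v * I + k * (2 * Real.pi))).im = z.im - v := by simp
    rw [e1, e2]
    linarith [Real.pi_lt_d2]
  · rw [cos_add_int_mul_two_pi, cos_mul_I, ← ofReal_cosh, hvc]
    norm_cast

/-- Schottky's theorem: a bound for a function omitting `0` and `1` in terms of its value at the
centre. -/
theorem exists_bound_of_omits_zero_one (α : ℝ) :
    ∃ M : ℝ, ∀ (f : ℂ → ℂ) (c : ℂ) (R : ℝ), 0 < R → DifferentiableOn ℂ f (ball c R) →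
      (∀ z ∈ ball c R, f z ≠ 0) → (∀ z ∈ ball c R, f z ≠ 1) → ‖f c‖ ≤ α →
      ∀ z ∈ ball c (R / 2), ‖f z‖ ≤ M := by
  have hpi := Real.pi_pos
  set β : ℝ := Real.pi + (Real.pi + (2 * α + 1)) / Real.pi + 576 with hβ
  refine ⟨(Real.exp (Real.pi * Real.exp β) + 1) / 2, fun f c R hR hf h0 h1 hα z hz => ?_⟩
  have hc : c ∈ ball c R := mem_ball_self hR
  -- Two arccosines are taken. `2 f - 1 = cos F` omits `±1`, so `F` omits `πℤ`; then `F / π = cos G`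
  -- omits all integers, so the values of `G` avoid a relatively dense set.
  obtain ⟨F, hF, hFe, hFc⟩ := exists_differentiableOn_cos_eq (f := fun z => 2 * f z - 1) hR
    ((hf.const_mul 2).sub_const 1)
    (fun z hz h => h1 z hz (by linear_combination h / 2))
    (fun z hz h => h0 z hz (by linear_combination h / 2))
  have hFint : ∀ w ∈ ball c R, ∀ n : ℤ, F w ≠ n * Real.pi := by
    intro w hw n hn
    have h2 := hFe w hw
    have hs : (2 * f w - 1 - 1) * (2 * f w - 1 + 1) = 0 := by
      have h3 := cos_sq_add_sin_sq (F w)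
      rw [h2, hn, sin_int_mul_pi] at h3
      linear_combination h3
    rcases mul_eq_zero.1 hs with h | h
    · exact h1 w hw (by linear_combination h / 2)
    · exact h0 w hw (by linear_combination h / 2)
  have hpic : (Real.pi : ℂ) ≠ 0 := by exact_mod_cast hpi.ne'
  obtain ⟨G, hG, hGe, hGc⟩ := exists_differentiableOn_cos_eq (f := fun z => F z / Real.pi) hR
    (hF.div_const _)
    (fun w hw h => hFint w hw 1 (by rw [div_eq_iff hpic] at h; simpa using h))
    (fun w hw h => hFint w hw (-1) (by rw [div_eq_iff hpic] at h; simpa using h))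
  have hGmiss : ∀ w ∈ ball c R, ∀ n : ℤ, cos (G w) ≠ n := by
    intro w hw n hn
    refine hFint w hw n ?_
    rw [hGe w hw, div_eq_iff hpic] at hn
    exact hn
  -- The image of `G` contains no disc of radius `6`, so Bloch's theorem applies to `G / 6` on discs
  -- of radius `R / 2`; the constant is `6 · 96 · 2`.
  have hderiv : ∀ w ∈ ball c (R / 2), ‖deriv G w‖ ≤ 1152 / R := by
    intro w hw
    have hsub : ball w (R / 2) ⊆ ball c R := by
      intro x hx
      rw [mem_ball] at *
      linarith [dist_triangle x w c]
    have hd : DifferentiableAt ℂ G w :=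
      hG.differentiableAt (isOpen_ball.mem_nhds (hsub (mem_ball_self (by positivity))))
    have h2 := norm_deriv_le_of_no_unit_ball_subset_image (g := fun x => G x / 6) (c := w)
      (R := R / 2) (by positivity) ((hG.mono hsub).div_const 6) (by
        intro x hx
        obtain ⟨u, hu, n, hn⟩ := exists_cos_eq_int_mem_ball (6 * x)
        obtain ⟨v, hv, hve⟩ := hx (a := u / 6) (by
          rw [mem_ball, dist_eq_norm] at hu ⊢
          have : u / 6 - x = (u - 6 * x) / 6 := by ring
          rw [this, norm_div, norm_ofNat]
          linarith)
        have hGv : G v = u := by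
          simp only at hve
          linear_combination 6 * hve
        exact hGmiss v (hsub hv) n (by rw [hGv, hn]))
    rw [deriv_div_const, norm_div, norm_ofNat, div_le_iff₀ (by norm_num)] at h2
    refine h2.trans (le_of_eq ?_)
    field_simp
    norm_num
  have hcR : c ∈ ball c (R / 2) := mem_ball_self (by positivity)
  have hhalf : ball c (R / 2) ⊆ ball c R := ball_subset_ball (by linarith)
  have hGz : ‖G z‖ ≤ β := by
    have h2 := (convex_ball c (R / 2)).norm_image_sub_le_of_norm_deriv_le
      (fun w hw => hG.differentiableAt (isOpen_ball.mem_nhds (hhalf hw))) hderiv hcR hz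
    have h3 : 1152 / R * ‖z - c‖ ≤ 576 := by
      rw [mem_ball, dist_eq_norm] at hz
      calc 1152 / R * ‖z - c‖ ≤ 1152 / R * (R / 2) := by gcongr
        _ = 576 := by field_simp; norm_num
    have h4 : ‖2 * f c - 1‖ ≤ 2 * α + 1 := by
      refine (norm_sub_le _ _).trans ?_
      rw [norm_mul, norm_ofNat, norm_one]
      linarith
    have h5 : ‖F c / Real.pi‖ ≤ (Real.pi + (2 * α + 1)) / Real.pi := by
      rw [norm_div, norm_real, Real.norm_eq_abs, abs_of_pos hpi]
      gcongr
      linarith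
    have h6 := norm_sub_norm_le (G z) (G c)
    linarith
  have hFz : ‖F z‖ ≤ Real.pi * Real.exp β := by
    have h2 := norm_cos_le_exp_norm (G z)
    rw [hGe z (hhalf hz), norm_div, norm_real, Real.norm_eq_abs, abs_of_pos hpi,
      div_le_iff₀ hpi] at h2
    have h3 := Real.exp_le_exp.2 hGz
    nlinarith
  have h2 := norm_cos_le_exp_norm (F z)
  rw [hFe z (hhalf hz)] at h2
  have h3 := Real.exp_le_exp.2 hFz
  have h4 := norm_sub_norm_le (2 * f z) 1
  rw [norm_mul, norm_ofNat, norm_one] at h4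
  linarith

/-- Montel's theorem for bounded sequences of holomorphic functions on a disc. -/
theorem exists_subseq_tendstoUniformlyOn {f : ℕ → ℂ → ℂ} {c : ℂ} {R M : ℝ} (hR : 0 < R)
    (hf : ∀ n, DifferentiableOn ℂ (f n) (ball c R)) (hM : ∀ n, ∀ z ∈ ball c R, ‖f n z‖ ≤ M) :
    ∃ φ : ℕ → ℕ, StrictMono φ ∧ ∃ g : ℂ → ℂ,
      TendstoUniformlyOn (fun k => f (φ k)) g atTop (closedBall c (R / 2)) := by
  have hsub : closedBall c (R / 2) ⊆ ball c R := closedBall_subset_ball (by linarith)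
  have : CompactSpace (closedBall c (R / 2)) :=
    isCompact_iff_compactSpace.1 (isCompact_closedBall c (R / 2))
  let F : ℕ → BoundedContinuousFunction (closedBall c (R / 2)) ℂ := fun n =>
    BoundedContinuousFunction.mkOfCompact
      ⟨(closedBall c (R / 2)).domRestrict (f n),
        ((hf n).continuousOn.mono hsub).domRestrict⟩
  have hFapp : ∀ n x, F n x = f n x := fun n x => rfl
  have hcomp : IsCompact (closure (range F)) := by
    refine BoundedContinuousFunction.arzela_ascoli (closedBall 0 M) (isCompact_closedBall _ _)
      (range F) ?_ ?_
    · rintro _ x ⟨n, rfl⟩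
      rw [mem_closedBall_zero_iff, hFapp]
      exact hM n x (hsub x.2)
    · intro x
      rw [Metric.equicontinuousAt_iff]
      intro ε hε
      refine ⟨min (R / 2) (ε / (2 * M / (R / 2) + 1)), ?_, ?_⟩
      · have hM0 : 0 ≤ M := (norm_nonneg _).trans (hM 0 c (mem_ball_self hR))
        positivity
      rintro y hy ⟨_, n, rfl⟩
      have hM0 : 0 ≤ M := (norm_nonneg _).trans (hM 0 c (mem_ball_self hR))
      rw [lt_min_iff] at hy
      have hxb : ball (x : ℂ) (R / 2) ⊆ ball c R := by
        intro u hu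
        have := x.2
        rw [mem_ball] at *
        rw [mem_closedBall] at this
        linarith [dist_triangle u x c]
      have h1 := dist_le_div_mul_dist_of_mapsTo_ball (f := f n) (c := (x : ℂ)) (R₁ := R / 2) (R₂ := 2 * M)
        (z := (y : ℂ)) ((hf n).mono hxb) (by
        intro u hu
        rw [mem_closedBall, dist_eq_norm]
        linarith [norm_sub_le (f n u) (f n x), hM n u (hxb hu), hM n x (hsub x.2)])
        (by rw [mem_ball]; exact hy.1)
      change dist (f n x) (f n y) < ε
      rw [dist_comm]
      refine h1.trans_lt ?_
      have h2 := hy.2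
      rw [lt_div_iff₀ (by positivity), Subtype.dist_eq] at h2
      have h3 : 0 ≤ dist (y : ℂ) x := dist_nonneg
      nlinarith
  obtain ⟨G, -, φ, hφ, hlim⟩ := hcomp.tendsto_subseq (fun n => subset_closure (mem_range_self n))
  refine ⟨φ, hφ, Function.extend Subtype.val G 0, ?_⟩
  rw [BoundedContinuousFunction.tendsto_iff_tendstoUniformly] at hlim
  rw [tendstoUniformlyOn_iff_tendstoUniformly_comp_coe]
  have e : Function.extend (Subtype.val : closedBall c (R / 2) → ℂ) G 0 ∘ Subtype.val = G :=
    funext fun x => Subtype.val_injective.extend_apply _ _ x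
  rw [e]
  exact hlim

theorem tendsto_coe_sphere_cobounded :
    Tendsto (fun z : ℂ => (z : Sphere)) (Bornology.cobounded ℂ) (𝓝 OnePoint.infty) := by
  rw [Metric.cobounded_eq_cocompact, ← coclosedCompact_eq_cocompact]
  exact OnePoint.tendsto_coe_infty

open Classical in
/-- The map `u ↦ b / u` from the plane into the sphere. -/
noncomputable def divSphere (b u : ℂ) : Sphere := if u = 0 then OnePoint.infty else ((b / u : ℂ) : Sphere)

theorem divSphere_of_ne {b u : ℂ} (hu : u ≠ 0) : divSphere b u = ((b / u : ℂ) : Sphere) :=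
  if_neg hu

theorem continuous_divSphere {b : ℂ} (hb : b ≠ 0) : Continuous (divSphere b) := by
  rw [continuous_iff_continuousAt]
  intro u
  rcases eq_or_ne u 0 with rfl | hu
  · rw [continuousAt_iff_punctured_nhds]
    have h0 : divSphere b 0 = OnePoint.infty := if_pos rfl
    rw [h0]
    have h1 : Tendsto (fun v : ℂ => b * v⁻¹) (𝓝[≠] 0) (Bornology.cobounded ℂ) :=
      (tendsto_mul_left_cobounded hb).comp tendsto_inv₀_nhdsNE_zero
    refine (tendsto_coe_sphere_cobounded.comp h1).congr' ?_
    filter_upwards [self_mem_nhdsWithin] with v hv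
    rw [divSphere_of_ne hv, div_eq_mul_inv]
    rfl
  · have h1 : ContinuousAt (fun v : ℂ => ((b / v : ℂ) : Sphere)) u :=
      OnePoint.continuous_coe.continuousAt.comp (continuousAt_const.div continuousAt_id hu)
    refine h1.congr ?_
    filter_upwards [isOpen_ne.mem_nhds hu] with v hv
    rw [divSphere_of_ne hv]

/-- A continuous `ι` is uniformly continuous on the closed disc of radius `M`, so uniform
convergence in the plane passes to the sphere. It is used with `u ↦ b u` and `u ↦ b / u`, to treat
finite and infinite limits alike. -/
theorem exists_subseq_tendstoLocallyUniformlyOn_comp {f : ℕ → ℂ → ℂ} {F : ℕ → ℂ → Sphere}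
    {ι : ℂ → Sphere} {c : ℂ} {R M : ℝ} (hR : 0 < R) (hι : Continuous ι)
    (hf : ∀ n, DifferentiableOn ℂ (f n) (ball c R)) (hM : ∀ n, ∀ z ∈ ball c R, ‖f n z‖ ≤ M)
    (hF : ∀ n, ∀ z ∈ ball c R, F n z = ι (f n z)) :
    let _ : UniformSpace Sphere := uniformSpaceOfCompactR1
    ∃ φ : ℕ → ℕ, StrictMono φ ∧ ∃ g : ℂ → Sphere,
      TendstoLocallyUniformlyOn (fun k => F (φ k)) g atTop (ball c (R / 2)) := by
  let _ : UniformSpace Sphere := uniformSpaceOfCompactR1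
  obtain ⟨φ, hφ, g, hg⟩ := exists_subseq_tendstoUniformlyOn hR hf hM
  refine ⟨φ, hφ, ι ∘ g, TendstoUniformlyOn.tendstoLocallyUniformlyOn ?_⟩
  have hsub : ball c (R / 2) ⊆ ball c R := ball_subset_ball (by linarith)
  have hg' := hg.mono ball_subset_closedBall
  have hgM : ∀ z ∈ ball c (R / 2), g z ∈ closedBall (0 : ℂ) M := fun z hz =>
    isClosed_closedBall.mem_of_tendsto (hg'.tendsto_at hz)
      (Eventually.of_forall fun k => mem_closedBall_zero_iff.2 (hM _ z (hsub hz)))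
  have huc : UniformContinuousOn ι (closedBall 0 M) :=
    (isCompact_closedBall 0 M).uniformContinuousOn_of_continuous hι.continuousOn
  have := UniformContinuousOn.comp_tendstoUniformlyOn_eventually
    (Eventually.of_forall fun k z hz => mem_closedBall_zero_iff.2 (hM (φ k) z (hsub hz)))
    hgM huc hg'
  exact this.congr (Eventually.of_forall fun k z hz => (hF _ z (hsub hz)).symm)

/-- Montel's fundamental normality test on a disc. -/
theorem isNormalFamilyOn_of_omits {ι : Type*} {F : ι → ℂ → ℂ} {b c : ℂ} {R : ℝ} (hR : 0 < R)
    (hb : b ≠ 0) (hF : ∀ i, DifferentiableOn ℂ (F i) (ball c R))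
    (h0 : ∀ i, ∀ z ∈ ball c R, F i z ≠ 0) (h1 : ∀ i, ∀ z ∈ ball c R, F i z ≠ b) :
    IsNormalFamilyOn (fun i z => (F i z : Sphere)) (ball c (R / 4)) := by
  intro s
  obtain ⟨M, hM⟩ := exists_bound_of_omits_zero_one 1
  have hsub : ball c (R / 2) ⊆ ball c R := ball_subset_ball (by linarith)
  have e4 : R / 4 = R / 2 / 2 := by ring
  have hbpos : 0 < ‖b‖ := norm_pos_iff.2 hb
  -- Along a subsequence either `F / b` or `b / F` is at most `1` in norm at the centre, and both
  -- omit `0` and `1`. Schottky's bound and the extraction of a limit each halve the radius, whence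
  -- `R / 4`.
  have hcases : (∃ᶠ n in atTop, ‖F (s n) c‖ ≤ ‖b‖) ∨ ∃ᶠ n in atTop, ‖b‖ ≤ ‖F (s n) c‖ := by
    rw [← frequently_or_distrib]
    exact (Eventually.of_forall fun n => le_total _ _).frequently
  rcases hcases with h | h
  · obtain ⟨ψ, hψ, hψb⟩ := extraction_of_frequently_atTop h
    obtain ⟨φ, hφ, g, hg⟩ := exists_subseq_tendstoLocallyUniformlyOn_comp
      (f := fun n z => F (s (ψ n)) z / b) (F := fun n z => (F (s (ψ n)) z : Sphere))
      (ι := fun u => ((b * u : ℂ) : Sphere)) (c := c) (R := R / 2) (M := M) (by positivity)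
      (OnePoint.continuous_coe.comp (continuous_const.mul continuous_id))
      (fun n => ((hF _).mono hsub).div_const b)
      (fun n => hM (fun z => F (s (ψ n)) z / b) c R hR ((hF _).div_const b)
        (fun z hz => div_ne_zero (h0 _ z hz) hb)
        (fun z hz h => h1 _ z hz ((div_eq_one_iff_eq hb).1 h))
        (by rw [norm_div]; exact div_le_one_of_le₀ (hψb n) hbpos.le))
      (fun n z hz => by rw [mul_div_cancel₀ _ hb])
    exact ⟨ψ ∘ φ, hψ.comp hφ, g, e4 ▸ hg⟩
  · obtain ⟨ψ, hψ, hψb⟩ := extraction_of_frequently_atTop h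
    obtain ⟨φ, hφ, g, hg⟩ := exists_subseq_tendstoLocallyUniformlyOn_comp
      (f := fun n z => b / F (s (ψ n)) z) (F := fun n z => (F (s (ψ n)) z : Sphere))
      (ι := divSphere b) (c := c) (R := R / 2) (M := M) (by positivity)
      (continuous_divSphere hb)
      (fun n => (differentiableOn_const b).div ((hF _).mono hsub) (fun z hz => h0 _ z (hsub hz)))
      (fun n => hM (fun z => b / F (s (ψ n)) z) c R hR
        ((differentiableOn_const b).div (hF _) (h0 _))
        (fun z hz => div_ne_zero hb (h0 _ z hz))
        (fun z hz h => h1 _ z hz ((div_eq_one_iff_eq (h0 _ z hz)).1 h).symm)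
        (by rw [norm_div]; exact div_le_one_of_le₀ (hψb n) (norm_nonneg _)))
      (fun n z hz => by
        rw [divSphere_of_ne (div_ne_zero hb (h0 _ z (hsub hz))), div_div_cancel₀ hb])
    exact ⟨ψ ∘ φ, hψ.comp hφ, g, e4 ▸ hg⟩

end Montel

/-! ### Picard's theorem at an essential singularity -/

section Picard

open Metric Complex

/-- A holomorphic function on a punctured disc which is bounded by the same constant on the
boundaries of arbitrarily small neighbourhoods of the puncture is bounded near the puncture, hence
meromorphic. -/
theorem meromorphicAt_zero_of_frontier_bound {h : ℂ → ℂ} {ρ C : ℝ} (hρ : 0 < ρ)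
    (hh : DifferentiableOn ℂ h (ball 0 ρ \ {0}))
    (hW : ∀ ε > 0, ∃ W : Set ℂ, IsOpen W ∧ 0 ∈ W ∧ W ⊆ ball 0 ε ∧ ∀ z ∈ frontier W, ‖h z‖ ≤ C) :
    MeromorphicAt h 0 := by
  obtain ⟨W₀, hW₀o, hW₀0, hW₀s, hW₀C⟩ := hW (ρ / 2) (by positivity)
  have hcl₀ : closure W₀ ⊆ ball 0 ρ :=
    (closure_minimal (hW₀s.trans ball_subset_closedBall) isClosed_closedBall).trans
      (closedBall_subset_ball (by linarith))
  have hbound : ∀ z ∈ W₀ \ {0}, ‖h z‖ ≤ C := by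
    rintro z ⟨hz, hz0⟩
    have hzpos : 0 < ‖z‖ := norm_pos_iff.2 hz0
    obtain ⟨W₁, hW₁o, hW₁0, hW₁s, hW₁C⟩ := hW (‖z‖ / 2) (by positivity)
    have hcl₁ : closure W₁ ⊆ closedBall 0 (‖z‖ / 2) :=
      closure_minimal (hW₁s.trans ball_subset_closedBall) isClosed_closedBall
    have hzU : z ∈ W₀ ∩ (closure W₁)ᶜ := by
      refine ⟨hz, fun hz1 => ?_⟩
      have := hcl₁ hz1
      rw [mem_closedBall_zero_iff] at this
      linarith
    have hclU : closure (W₀ ∩ (closure W₁)ᶜ) ⊆ ball 0 ρ \ {0} := by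
      intro w hw
      refine ⟨hcl₀ (closure_mono inter_subset_left hw), fun hw0 => ?_⟩
      rw [mem_singleton_iff] at hw0
      rw [hw0, _root_.mem_closure_iff] at hw
      obtain ⟨v, hv, hv'⟩ := hw W₁ hW₁o hW₁0
      exact hv'.2 (subset_closure hv)
    -- Maximum principle on the region between `∂W₀` and `∂W₁`: it contains `z`, its closure avoids
    -- the puncture, and the bound `C` holds on its whole boundary.
    refine norm_le_of_forall_mem_frontier_norm_le (U := W₀ ∩ (closure W₁)ᶜ)
      (isBounded_ball.subset (inter_subset_left.trans hW₀s))
      (hh.mono hclU).diffContOnCl (fun w hw => ?_) (subset_closure hzU)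
    rcases frontier_inter_subset _ _ hw with h1 | h1
    · exact hW₀C w h1.1
    · have h2 := h1.2
      rw [frontier_compl] at h2
      exact hW₁C w (frontier_closure_subset h2)
  have hd := differentiableOn_update_limUnder_of_bddAbove (hW₀o.mem_nhds hW₀0)
    (hh.mono (sdiff_subset_sdiff_left (subset_closure.trans hcl₀)))
    ⟨C, by rintro _ ⟨z, hz, rfl⟩; exact hbound z hz⟩
  refine (hd.analyticAt (hW₀o.mem_nhds hW₀0)).meromorphicAt.congr ?_
  filter_upwards [self_mem_nhdsWithin] with z hz
  exact Function.update_of_ne hz _ _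

/-- Picard's great theorem for functions omitting `0` and `1` near an isolated singularity. -/
theorem meromorphicAt_zero_of_omits {h : ℂ → ℂ} {ρ : ℝ} (hρ : 0 < ρ)
    (hh : DifferentiableOn ℂ h (ball 0 ρ \ {0})) (h0 : ∀ z ∈ ball 0 ρ \ {0}, h z ≠ 0)
    (h1 : ∀ z ∈ ball 0 ρ \ {0}, h z ≠ 1) : MeromorphicAt h 0 := by
  obtain ⟨M, hM⟩ := exists_bound_of_omits_zero_one 1
  have hpi := Real.pi_pos
  -- one application of Schottky's theorem on a disc covering a circle
  have hcircle : ∀ k : ℂ → ℂ, DifferentiableOn ℂ k (ball 0 ρ \ {0}) →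
      (∀ z ∈ ball 0 ρ \ {0}, k z ≠ 0) → (∀ z ∈ ball 0 ρ \ {0}, k z ≠ 1) →
      ∀ t : ℝ, t < Real.log ρ - 4 * Real.pi → ‖k (exp t)‖ ≤ 1 →
      ∀ z, ‖z‖ = Real.exp t → ‖k z‖ ≤ M := by
    intro k hk hk0 hk1 t ht hkt z hz
    -- In the coordinate `exp`, the disc of half the radius `4π` about `t` contains the segment from
    -- `t - iπ` to `t + iπ`, which covers the circle of radius `exp t`.
    have hmap : MapsTo exp (ball (t : ℂ) (4 * Real.pi)) (ball 0 ρ \ {0}) := by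
      intro w hw
      refine ⟨?_, exp_ne_zero w⟩
      rw [mem_ball_zero_iff, norm_exp, ← Real.lt_log_iff_exp_lt hρ]
      rw [mem_ball, dist_eq_norm] at hw
      have := (abs_le.1 (abs_re_le_norm (w - t))).2
      simp only [sub_re, ofReal_re] at this
      linarith
    have hz0 : z ≠ 0 := by
      rintro rfl
      rw [norm_zero] at hz
      exact (Real.exp_pos t).ne hz
    have hlog : log z ∈ ball (t : ℂ) (4 * Real.pi / 2) := by
      rw [mem_ball, dist_eq_norm]
      refine (norm_le_abs_re_add_abs_im _).trans_lt ?_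
      simp only [sub_re, ofReal_re, sub_im, ofReal_im, sub_zero, log_re, log_im, hz, Real.log_exp,
        sub_self, abs_zero, zero_add]
      linarith [abs_arg_le_pi z]
    have := hM (k ∘ exp) t (4 * Real.pi) (by positivity)
      (hk.comp differentiable_exp.differentiableOn hmap) (fun w hw => hk0 _ (hmap hw))
      (fun w hw => hk1 _ (hmap hw)) hkt (log z) hlog
    rwa [Function.comp_apply, exp_log hz0] at this
  have hmain : ∀ k : ℂ → ℂ, DifferentiableOn ℂ k (ball 0 ρ \ {0}) →
      (∀ z ∈ ball 0 ρ \ {0}, k z ≠ 0) → (∀ z ∈ ball 0 ρ \ {0}, k z ≠ 1) →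
      (∃ᶠ t : ℝ in atBot, ‖k (exp t)‖ ≤ 1) → MeromorphicAt k 0 := by
    intro k hk hk0 hk1 hfreq
    refine meromorphicAt_zero_of_frontier_bound (C := M) hρ hk fun ε hε => ?_
    obtain ⟨t, ht, ht1, ht2⟩ := (hfreq.and_eventually
      ((eventually_lt_atBot (Real.log ρ - 4 * Real.pi)).and
        (eventually_lt_atBot (Real.log ε)))).exists
    have hte : Real.exp t < ε := (Real.lt_log_iff_exp_lt hε).1 ht2
    refine ⟨ball 0 (Real.exp t), isOpen_ball, mem_ball_self (Real.exp_pos t),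
      ball_subset_ball hte.le, fun z hz => ?_⟩
    rw [frontier_ball _ (Real.exp_pos t).ne', mem_sphere_zero_iff_norm] at hz
    exact hcircle k hk hk0 hk1 t ht1 ht z hz
  have hcases : (∃ᶠ t : ℝ in atBot, ‖h (exp t)‖ ≤ 1) ∨ ∃ᶠ t : ℝ in atBot, 1 ≤ ‖h (exp t)‖ := by
    rw [← frequently_or_distrib]
    exact (Eventually.of_forall fun n => le_total _ _).frequently
  rcases hcases with hc | hc
  · exact hmain h hh h0 h1 hc
  · have := hmain h⁻¹ (hh.inv h0) (fun z hz => inv_ne_zero (h0 z hz))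
      (fun z hz e => h1 z hz (inv_eq_one.1 e)) (hc.mono fun t ht => by
        rw [Pi.inv_apply, norm_inv]
        exact inv_le_one_of_one_le₀ ht)
    simpa using this.inv

theorem frequently_eq_one_of_not_meromorphicAt {h : ℂ → ℂ} (hh : DifferentiableOn ℂ h Cstar)
    (h0 : ∀ z ∈ Cstar, h z ≠ 0) (hm : ¬ MeromorphicAt h 0) : ∃ᶠ z in 𝓝[≠] 0, h z = 1 := by
  by_contra hcon
  rw [not_frequently, eventually_nhdsWithin_iff, Metric.eventually_nhds_iff_ball] at hcon
  obtain ⟨ρ, hρ, hball⟩ := hcon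
  have hsub : ball (0 : ℂ) ρ \ {0} ⊆ Cstar := fun z hz => hz.2
  exact hm (meromorphicAt_zero_of_omits hρ (hh.mono hsub) (fun z hz => h0 z (hsub hz))
    (fun z hz => hball z hz.1 hz.2))

variable {f : ℂ → ℂ}

theorem IsTranscendentalSelfMapCstar.frequently_eq (hf : IsTranscendentalSelfMapCstar f) {a : ℂ}
    (ha : a ≠ 0) : ∃ᶠ z in 𝓝[≠] 0, f z = a := by
  refine (frequently_eq_one_of_not_meromorphicAt (h := fun z => f z / a)
    (hf.differentiableOn.div_const a) (fun z hz => div_ne_zero (hf.mapsTo hz) ha)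
    (fun hm => hf.essential_zero ?_)).mono fun z hz => (div_eq_one_iff_eq ha).1 hz
  refine (hm.mul (MeromorphicAt.const a 0)).congr (Eventually.of_forall fun z => ?_)
  exact div_mul_cancel₀ _ ha

/-- Picard's theorem for `f z / z`, which does not vanish on the punctured plane and is still
essentially singular at `0`. -/
theorem IsTranscendentalSelfMapCstar.frequently_fixed (hf : IsTranscendentalSelfMapCstar f) :
    ∃ᶠ z in 𝓝[≠] 0, f z = z := by
  have := frequently_eq_one_of_not_meromorphicAt (h := fun z => f z / z)
    (hf.differentiableOn.div differentiableOn_id fun z hz => hz)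
    (fun z hz => div_ne_zero (hf.mapsTo hz) hz)
    (fun hm => hf.essential_zero ?_)
  · exact (this.and_eventually self_mem_nhdsWithin).mono fun z hz =>
      (div_eq_one_iff_eq hz.2).1 hz.1
  · refine (hm.mul (MeromorphicAt.id 0)).congr ?_
    filter_upwards [self_mem_nhdsWithin] with z hz
    exact div_mul_cancel₀ _ hz

end Picard

/-! ### The Julia set is non-empty, and its neighbourhoods expand -/

section Julia

open Metric Complex

variable {f : ℂ → ℂ}

theorem isOpen_Cstar : IsOpen Cstar := isOpen_compl_singleton

theorem IsTranscendentalSelfMapCstar.differentiableOn_iterate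
    (hf : IsTranscendentalSelfMapCstar f) (n : ℕ) : DifferentiableOn ℂ f^[n] Cstar :=
  hf.differentiableOn.iterate hf.mapsTo n

theorem IsTranscendentalSelfMapCstar.continuousAt_iterate
    (hf : IsTranscendentalSelfMapCstar f) (n : ℕ) {z : ℂ} (hz : z ∈ Cstar) :
    ContinuousAt f^[n] z :=
  ((hf.differentiableOn_iterate n).differentiableAt (isOpen_Cstar.mem_nhds hz)).continuousAt

/-- A holomorphic function bounded by `M` on a disc is Lipschitz near every point of the disc. -/
theorem dist_le_of_norm_le {h : ℂ → ℂ} {c : ℂ} {r M : ℝ} (hh : DifferentiableOn ℂ h (ball c r))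
    (hM : ∀ z ∈ ball c r, ‖h z‖ ≤ M) {z : ℂ} (hz : z ∈ ball c r) :
    dist (h z) (h c) ≤ 2 * M / r * dist z c := by
  refine dist_le_div_mul_dist_of_mapsTo_ball hh (fun w hw => ?_) hz
  rw [mem_closedBall, dist_eq_norm]
  linarith [norm_sub_le (h w) (h c), hM w hw,
    hM c (mem_ball_self (dist_nonneg.trans_lt (mem_ball.1 hz)))]

/-- Along an ultrafilter, a bounded family of holomorphic functions converges to a holomorphic
function. -/
theorem exists_differentiableOn_ultrafilter_limit {ι : Type*} (𝒰 : Ultrafilter ι)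
    {F : ι → ℂ → ℂ} {c : ℂ} {r M : ℝ} (hF : ∀ i, DifferentiableOn ℂ (F i) (ball c r))
    (hM : ∀ᶠ i in 𝒰, ∀ z ∈ ball c r, ‖F i z‖ ≤ M) :
    ∃ G : ℂ → ℂ, DifferentiableOn ℂ G (ball c r) ∧
      ∀ z ∈ ball c r, Tendsto (fun i => F i z) 𝒰 (𝓝 (G z)) := by
  have hlim : ∀ z ∈ ball c r, ∃ w, Tendsto (fun i => F i z) 𝒰 (𝓝 w) := by
    intro z hz
    obtain ⟨w, -, hw⟩ := (isCompact_closedBall (0 : ℂ) M).ultrafilter_le_nhds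
      (𝒰.map fun i => F i z) (by
        rw [le_principal_iff]
        exact hM.mono fun i hi => mem_closedBall_zero_iff.2 (hi z hz))
    exact ⟨w, hw⟩
  choose! G hG using hlim
  refine ⟨G, TendstoLocallyUniformlyOn.differentiableOn (F := F) (φ := (𝒰 : Filter ι)) ?_
    (Eventually.of_forall hF) isOpen_ball, hG⟩
  rw [Metric.tendstoLocallyUniformlyOn_iff]
  intro ε hε x hx
  obtain ⟨s, hs, hsub⟩ : ∃ s > 0, ball x s ⊆ ball c r := Metric.isOpen_iff.1 isOpen_ball x hx
  have hM0 : 0 ≤ M := by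
    obtain ⟨i, hi⟩ := hM.exists
    exact (norm_nonneg _).trans (hi x hx)
  -- A common Lipschitz bound about `x` for the family, inherited by `G`, upgrades pointwise to
  -- locally uniform convergence, so that `G` is holomorphic.
  have hlip : ∀ᶠ i in 𝒰, ∀ z ∈ ball x s, dist (F i z) (F i x) ≤ 2 * M / s * dist z x :=
    hM.mono fun i hi z hz => dist_le_of_norm_le ((hF i).mono hsub) (fun w hw => hi w (hsub hw)) hz
  have hGlip : ∀ z ∈ ball x s, dist (G z) (G x) ≤ 2 * M / s * dist z x := fun z hz =>
    le_of_tendsto ((hG z (hsub hz)).dist (hG x hx)) (hlip.mono fun i hi => hi z hz)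
  have hδ : 0 < min s (ε / (3 * (2 * M / s + 1))) := by positivity
  refine ⟨ball x (min s (ε / (3 * (2 * M / s + 1)))),
    mem_nhdsWithin_of_mem_nhds (ball_mem_nhds x hδ), ?_⟩
  filter_upwards [hlip, Metric.tendsto_nhds.1 (hG x hx) (ε / 3) (by positivity)] with i hi hix z hz
  rw [mem_ball, lt_min_iff] at hz
  have h1 := hi z hz.1
  have h2 := hGlip z hz.1
  have h3 := hz.2
  rw [lt_div_iff₀ (by positivity)] at h3
  have h4 : 0 ≤ dist z x := dist_nonneg
  have h5 := dist_triangle (G z) (G x) (F i z)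
  have h6 := dist_triangle (G x) (F i x) (F i z)
  rw [dist_comm (G x) (F i x), dist_comm (F i x) (F i z)] at h6
  nlinarith

/-- Near a point of the Fatou set, an iterate which takes at some point a value close to `a` stays
close to `a`. -/
theorem exists_ball_of_mem_fatouSet (hf : IsTranscendentalSelfMapCstar f) {z₀ : ℂ}
    (hz₀ : z₀ ∈ fatouSet f) (a : ℂ) :
    ∃ r > 0, ball z₀ r ⊆ Cstar ∧ ∃ δ > 0, ∀ n : ℕ, (∃ s ∈ ball z₀ r, dist (f^[n] s) a < δ) →
      ∀ z ∈ ball z₀ r, dist (f^[n] z) a < 1 := by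
  obtain ⟨V, hVo, hzV, hVC, hV⟩ := hz₀
  obtain ⟨ρ, hρ, hρV⟩ := Metric.isOpen_iff.1 hVo z₀ hzV
  by_contra! hcon
  -- Take counterexamples with `r` and `δ` tending to `0`. A limit `g` of the corresponding iterates
  -- is continuous at `z₀`; the points `s k` force `g z₀ = a`, and then the values at `z k` also
  -- tend to `a`.
  have hk : ∀ k : ℕ, ∃ n : ℕ, ∃ s ∈ ball z₀ (min ρ (1 / (k + 1))),
      ∃ z ∈ ball z₀ (min ρ (1 / (k + 1))), dist (f^[n] s) a < 1 / (k + 1) ∧ 1 ≤ dist (f^[n] z) a := by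
    intro k
    obtain ⟨n, ⟨s, hs, hs'⟩, z, hz, hz'⟩ := hcon (min ρ (1 / (k + 1))) (by positivity)
      ((ball_subset_ball (min_le_left _ _)).trans (hρV.trans hVC)) (1 / (k + 1)) (by positivity)
    exact ⟨n, s, hs, z, hz, hs', hz'⟩
  choose n s hs z hz hsa hza using hk
  let _ : UniformSpace Sphere := uniformSpaceOfCompactR1
  obtain ⟨φ, hφ, g, hg⟩ := hV n
  have hgc : ContinuousOn g V := hg.continuousOn (Eventually.of_forall fun k w hw =>
    (OnePoint.continuous_coe.continuousAt.comp
      (hf.continuousAt_iterate (n (φ k)) (hVC hw))).continuousWithinAt).frequently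
  have hone : Tendsto (fun k : ℕ => (1 / ((φ k : ℕ) + 1) : ℝ)) atTop (𝓝 0) :=
    tendsto_one_div_add_atTop_nhds_zero_nat.comp hφ.tendsto_atTop
  have hconv : ∀ x : ℕ → ℂ, (∀ k : ℕ, x k ∈ ball z₀ (min ρ (1 / (k + 1)))) →
      Tendsto (fun k => ((f^[n (φ k)] (x (φ k)) : ℂ) : Sphere)) atTop (𝓝 (g z₀)) := by
    intro x hx
    have hx0 : Tendsto (fun k => x (φ k)) atTop (𝓝 z₀) := by
      rw [tendsto_iff_dist_tendsto_zero]
      refine squeeze_zero (fun k => dist_nonneg) (fun k => ?_) hone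
      exact (mem_ball.1 (hx (φ k))).le.trans (min_le_right _ _)
    refine hg.tendsto_comp (hgc z₀ hzV) hzV (tendsto_nhdsWithin_iff.2 ⟨hx0, ?_⟩)
    exact Eventually.of_forall fun k => hρV (ball_subset_ball (min_le_left _ _) (hx (φ k)))
  have h1 : Tendsto (fun k => f^[n (φ k)] (s (φ k))) atTop (𝓝 a) := by
    rw [tendsto_iff_dist_tendsto_zero]
    exact squeeze_zero (fun k => dist_nonneg) (fun k => (hsa (φ k)).le) hone
  have h2 : g z₀ = (a : Sphere) := tendsto_nhds_unique (hconv s hs)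
    ((OnePoint.continuous_coe.tendsto a).comp h1)
  have h3 := hconv z hz
  rw [h2] at h3
  have h4 := h3.eventually ((OnePoint.isOpenEmbedding_coe.isOpenMap _ isOpen_ball).mem_nhds
    (mem_image_of_mem _ (mem_ball_self one_pos)))
  obtain ⟨k, y, hy, hyk⟩ := h4.exists
  rw [OnePoint.coe_injective hyk] at hy
  exact absurd (hza (φ k)) (not_le.2 hy)

theorem isPreconnected_Cstar : IsPreconnected Cstar :=
  (isConnected_compl_singleton_of_one_lt_rank (by simp) 0).isPreconnected

/-- If the Fatou set is everything, then a limit of iterates that agrees with an entire function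
locally agrees with it everywhere. -/
theorem eventually_tendsto_of_eventually_tendsto (hf : IsTranscendentalSelfMapCstar f)
    (hF : Cstar ⊆ fatouSet f) {ι : Type*} (𝒰 : Ultrafilter ι) (u : ι → ℕ) {φ : ℂ → ℂ}
    (hφ : Differentiable ℂ φ) {p : ℂ} (hp : p ∈ Cstar)
    (h : ∀ᶠ y in 𝓝 p, Tendsto (fun i => f^[u i] y) 𝒰 (𝓝 (φ y))) {z : ℂ} (hz : z ∈ Cstar) :
    Tendsto (fun i => f^[u i] z) 𝒰 (𝓝 (φ z)) := by
  -- Connectedness: the set of points near which the convergence holds is open. At a point `z₀` of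
  -- its closure the iterates are bounded on a ball, so their limit is holomorphic there and equals
  -- `φ` by the identity theorem.
  refine Eventually.self_of_nhds (p := fun y => Tendsto (fun i => f^[u i] y) 𝒰 (𝓝 (φ y)))
    (isPreconnected_Cstar.subset_of_closure_inter_subset
    (u := {x | ∀ᶠ y in 𝓝 x, Tendsto (fun i => f^[u i] y) 𝒰 (𝓝 (φ y))})
    isOpen_setOfPred_eventually_nhds ⟨p, hp, h⟩ ?_ hz)
  rintro z₀ ⟨hz₀, hz₀C⟩
  obtain ⟨r, hr, hrC, δ, hδ, hball⟩ := exists_ball_of_mem_fatouSet hf (hF hz₀C) (φ z₀)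
  have hn : ball z₀ r ∩ φ ⁻¹' ball (φ z₀) δ ∈ 𝓝 z₀ :=
    inter_mem (ball_mem_nhds _ hr) (hφ.continuous.continuousAt (ball_mem_nhds _ hδ))
  obtain ⟨s, ⟨hsr, hsδ⟩, hs⟩ := mem_closure_iff_nhds.1 hz₀ _ hn
  have hbd : ∀ᶠ i in 𝒰, ∀ z ∈ ball z₀ r, ‖f^[u i] z‖ ≤ ‖φ z₀‖ + 1 := by
    filter_upwards [hs.self_of_nhds (isOpen_ball.mem_nhds hsδ)] with i hi z hz
    have h1 := hball (u i) ⟨s, hsr, hi⟩ z hz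
    rw [dist_eq_norm] at h1
    linarith [norm_sub_norm_le (f^[u i] z) (φ z₀)]
  obtain ⟨G, hG, hGt⟩ := exists_differentiableOn_ultrafilter_limit 𝒰
    (fun i => (hf.differentiableOn_iterate (u i)).mono hrC) hbd
  have hGφ : G =ᶠ[𝓝 s] φ := by
    filter_upwards [hs, isOpen_ball.mem_nhds hsr] with y hy hyr
    exact tendsto_nhds_unique (hGt y hyr) hy
  have heq := (hG.analyticOnNhd isOpen_ball).eqOn_of_preconnected_of_eventuallyEq
    (hφ.differentiableOn.analyticOnNhd isOpen_ball) (convex_ball z₀ r).isPreconnected hsr hGφ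
  filter_upwards [ball_mem_nhds z₀ hr] with y hy
  rw [← heq hy]
  exact hGt y hy

/-- The Ellis–Numakura lemma. Limits of iterates along such an ultrafilter are idempotent under
composition where this makes sense. Positive integers are used because on `ℕ` the principal
ultrafilter at `0` would be a useless solution. -/
theorem exists_idempotent_ultrafilter_pnat :
    ∃ 𝒰 : Ultrafilter ℕ+, ∀ p : ℕ+ → Prop,
      (∀ᶠ m in 𝒰, p m) ↔ ∀ᶠ m in 𝒰, ∀ᶠ n in 𝒰, p (m + n) := by
  let _ : AddSemigroup (Ultrafilter ℕ+) := Ultrafilter.addSemigroup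
  obtain ⟨𝒰, h𝒰⟩ := exists_idempotent_of_compact_t2_of_continuous_add_left
    (@Ultrafilter.continuous_add_left ℕ+ _)
  refine ⟨𝒰, fun p => ?_⟩
  conv_lhs => rw [← h𝒰]
  exact Ultrafilter.eventually_add 𝒰 𝒰 p

/-- Picard's theorem gives fixed points `p ≠ q` and a point `w ≠ p` with `f w = p`. If all points
were Fatou points, the iterates would converge near `p`, along an idempotent ultrafilter, to a
holomorphic `G` with `G p = p`. If `G` is constant near `p`, the limit is `p` everywhere,
contradicting `q`. Otherwise `G` is open, the iterates tend to the identity on its image by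
idempotence, hence everywhere, contradicting `f^n w = p` for `n ≥ 1`. -/
theorem IsTranscendentalSelfMapCstar.juliaSet_nonempty (hf : IsTranscendentalSelfMapCstar f) :
    (juliaSet f).Nonempty := by
  by_contra hcon
  have hF : Cstar ⊆ fatouSet f := sdiff_eq_empty.1 (not_nonempty_iff_eq_empty.1 hcon)
  obtain ⟨p, hpf, hp⟩ := (hf.frequently_fixed.and_eventually self_mem_nhdsWithin).exists
  have hne : ∀ᶠ z in 𝓝[≠] (0 : ℂ), z ≠ p :=
    eventually_nhdsWithin_of_eventually_nhds (isOpen_ne.mem_nhds (Ne.symm hp))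
  obtain ⟨q, ⟨hqf, hqp⟩, hq⟩ :=
    ((hf.frequently_fixed.and_eventually hne).and_eventually self_mem_nhdsWithin).exists
  obtain ⟨w, ⟨hwf, hwp⟩, hw⟩ :=
    (((hf.frequently_eq hp).and_eventually hne).and_eventually self_mem_nhdsWithin).exists
  obtain ⟨𝒰, h𝒰⟩ := exists_idempotent_ultrafilter_pnat
  have hpn : ∀ n : ℕ, f^[n] p = p := fun n => Function.iterate_fixed hpf n
  obtain ⟨r, hr, hrC, δ, hδ, hball⟩ := exists_ball_of_mem_fatouSet hf (hF hp) p
  obtain ⟨G, hG, hGt⟩ := exists_differentiableOn_ultrafilter_limit 𝒰 (c := p) (r := r)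
    (M := ‖p‖ + 1) (fun n : ℕ+ => (hf.differentiableOn_iterate n).mono hrC)
    (Eventually.of_forall fun n z hz => by
      have h1 := hball n ⟨p, mem_ball_self hr, by rw [hpn, dist_self]; exact hδ⟩ z hz
      rw [dist_eq_norm] at h1
      linarith [norm_sub_norm_le (f^[n] z) p])
  have hGp : G p = p := by
    have := hGt p (mem_ball_self hr)
    simp only [hpn] at this
    exact tendsto_nhds_unique this tendsto_const_nhds |>.symm ▸ rfl
  have hGa : AnalyticAt ℂ G p := hG.analyticAt (ball_mem_nhds p hr)
  rcases hGa.eventually_constant_or_nhds_le_map_nhds with hc | hop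
  · have h1 := eventually_tendsto_of_eventually_tendsto hf hF 𝒰 (fun n : ℕ+ => (n : ℕ))
      (φ := fun _ => p) (differentiable_const p) hp (by
        filter_upwards [hc, ball_mem_nhds p hr] with y hy hyr
        have := hGt y hyr
        rwa [hy, hGp] at this) hq
    simp only [Function.iterate_fixed hqf] at h1
    exact hqp (tendsto_nhds_unique tendsto_const_nhds h1)
  · rw [hGp] at hop
    have hid : ∀ᶠ y in 𝓝 p, Tendsto (fun n : ℕ+ => f^[n] y) 𝒰 (𝓝 (id y)) := by
      refine hop ?_
      rw [mem_map]
      have hGr : ∀ᶠ z in 𝓝 p, G z ∈ ball p r := by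
        refine hGa.continuousAt ?_
        rw [hGp]
        exact ball_mem_nhds p hr
      filter_upwards [hGr, ball_mem_nhds p hr] with z hGz hz
      have h1 := hGt z hz
      -- For a closed neighbourhood `N` of `G z`, idempotence puts `f^(m+n) z` in `N` for most `m`
      -- and then most `n`; the limit in `n` puts `f^m (G z)` in `N`.
      refine (closed_nhds_basis (G z)).tendsto_right_iff.2 fun N hN => ?_
      have h2 := (h𝒰 _).1 (h1 hN.1)
      refine h2.mono fun m hm => ?_
      have h3 : Tendsto (fun n : ℕ+ => f^[m] (f^[n] z)) 𝒰 (𝓝 (f^[m] (G z))) :=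
        (hf.continuousAt_iterate m (hrC hGz)).tendsto.comp h1
      refine hN.2.mem_of_tendsto h3 (hm.mono fun n hn => ?_)
      have h4 : f^[((m + n : ℕ+) : ℕ)] z ∈ N := hn
      rwa [PNat.add_coe, Function.iterate_add_apply] at h4
    have h1 := eventually_tendsto_of_eventually_tendsto hf hF 𝒰 (fun n : ℕ+ => (n : ℕ))
      differentiable_id hp hid hw
    have h2 : ∀ n : ℕ+, f^[n] w = p := by
      intro n
      obtain ⟨k, hk⟩ := Nat.exists_eq_succ_of_ne_zero n.ne_zero
      rw [hk, Function.iterate_succ_apply, hwf, hpn]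
    simp only [h2] at h1
    exact hwp (tendsto_nhds_unique tendsto_const_nhds h1).symm

/-- The iterates of a neighbourhood of a point of the Julia set cover the punctured plane. -/
theorem IsTranscendentalSelfMapCstar.exists_mem_image_iterate
    (hf : IsTranscendentalSelfMapCstar f) {z : ℂ} (hz : z ∈ juliaSet f) {U : Set ℂ}
    (hU : IsOpen U) (hzU : z ∈ U) (hUC : U ⊆ Cstar) {b : ℂ} (hb : b ∈ Cstar) :
    ∃ n : ℕ, b ∈ f^[n] '' U := by
  by_contra! hcon
  obtain ⟨R, hR, hRU⟩ := Metric.isOpen_iff.1 hU z hzU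
  refine hz.2 ⟨ball z (R / 4), isOpen_ball, mem_ball_self (by positivity),
    (ball_subset_ball (by linarith)).trans (hRU.trans hUC), ?_⟩
  exact isNormalFamilyOn_of_omits (b := b) hR hb
    (fun n => (hf.differentiableOn_iterate n).mono (hRU.trans hUC))
    (fun n w hw => hf.mapsTo.iterate n (hUC (hRU hw)))
    (fun n w hw h => hcon n ⟨w, hRU hw, h⟩)

end Julia

/-! ### Components of open sets and of complements -/

section Components

variable {X : Type*} [TopologicalSpace X]

theorem closure_connectedComponentIn_inter_subset [LocallyConnectedSpace X] {U : Set X}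
    (hU : IsOpen U) (x : X) :
    closure (connectedComponentIn U x) ∩ U ⊆ connectedComponentIn U x := by
  rintro y ⟨hy, hyU⟩
  obtain ⟨w, hw, hw'⟩ := mem_closure_iff.1 hy _ (hU.connectedComponentIn (x := y))
    (mem_connectedComponentIn hyU)
  rw [connectedComponentIn_eq hw', ← connectedComponentIn_eq hw]
  exact mem_connectedComponentIn hyU

theorem frontier_connectedComponentIn_subset [LocallyConnectedSpace X] {U : Set X}
    (hU : IsOpen U) (x : X) : frontier (connectedComponentIn U x) ⊆ frontier U := by
  intro y hy
  rw [hU.connectedComponentIn.frontier_eq] at hy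
  rw [hU.frontier_eq]
  exact ⟨closure_mono (connectedComponentIn_subset U x) hy.1,
    fun hyU => hy.2 (closure_connectedComponentIn_inter_subset hU x ⟨hy.1, hyU⟩)⟩

/-- Let `G` be a component of the complement of a closed set `K`, and let `O₁`, `O₂` separate the
complement of `G`. If the part of `K` in `O₁` is connected, then so is the part of the complement
of `G` in `O₁`. -/
theorem isPreconnected_compl_connectedComponentIn_inter [PreconnectedSpace X]
    [LocallyConnectedSpace X] {K O₁ O₂ : Set X} {x : X} (hK : IsClosed K) (hO₁ : IsOpen O₁)
    (hO₂ : IsOpen O₂) (hO : Disjoint O₁ O₂) (hcov : (connectedComponentIn Kᶜ x)ᶜ ⊆ O₁ ∪ O₂)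
    (hc : IsConnected (K ∩ O₁)) : IsPreconnected ((connectedComponentIn Kᶜ x)ᶜ ∩ O₁) := by
  obtain ⟨⟨k, hk, hkO⟩, hpre⟩ := hc
  have hKG : K ⊆ (connectedComponentIn Kᶜ x)ᶜ := fun y hy h => connectedComponentIn_subset _ _ h hy
  refine isPreconnected_of_forall k fun y hy => ?_
  by_cases hyK : y ∈ K
  · exact ⟨K ∩ O₁, inter_subset_inter_left _ hKG, ⟨hk, hkO⟩, ⟨hyK, hy.2⟩, hpre⟩
  -- Another component of `Kᶜ` has a connected closure missing `G`, hence contained in `O₁`. The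
  -- closure meets `K`, since otherwise the component would be clopen; so it attaches to the
  -- connected set `K ∩ O₁`.
  have hyH : y ∈ connectedComponentIn Kᶜ y := mem_connectedComponentIn hyK
  have hHo : IsOpen (connectedComponentIn Kᶜ y) := hK.isOpen_compl.connectedComponentIn
  have hHpre : IsPreconnected (closure (connectedComponentIn Kᶜ y)) :=
    isPreconnected_connectedComponentIn.closure
  have hHG : closure (connectedComponentIn Kᶜ y) ⊆ (connectedComponentIn Kᶜ x)ᶜ := by
    refine closure_minimal (fun w hw hw' => hy.1 ?_)
      hK.isOpen_compl.connectedComponentIn.isClosed_compl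
    rw [connectedComponentIn_eq hw', ← connectedComponentIn_eq hw]
    exact hyH
  have hHO : closure (connectedComponentIn Kᶜ y) ⊆ O₁ :=
    hHpre.subset_left_of_subset_union hO₁ hO₂ hO (hHG.trans hcov) ⟨y, subset_closure hyH, hy.2⟩
  obtain ⟨w, hw, hwK⟩ : (closure (connectedComponentIn Kᶜ y) ∩ K).Nonempty := by
    by_contra hcon
    have hdisj : closure (connectedComponentIn Kᶜ y) ⊆ Kᶜ := fun w hw hwK => hcon ⟨w, hw, hwK⟩
    have hclosed : IsClosed (connectedComponentIn Kᶜ y) := isClosed_of_closure_subset fun w hw =>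
      closure_connectedComponentIn_inter_subset hK.isOpen_compl y ⟨hw, hdisj hw⟩
    have huniv := IsClopen.eq_univ ⟨hclosed, hHo⟩ ⟨y, hyH⟩
    exact connectedComponentIn_subset Kᶜ y (huniv ▸ mem_univ k) hk
  exact ⟨K ∩ O₁ ∪ closure (connectedComponentIn Kᶜ y),
    union_subset (inter_subset_inter_left _ hKG) (subset_inter hHG hHO),
    Or.inl ⟨hk, hkO⟩, Or.inr (subset_closure hyH), hpre.union w ⟨hwK, hHO hw⟩ hw hHpre⟩

theorem isPreconnected_compl_connectedComponentIn [PreconnectedSpace X]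
    [LocallyConnectedSpace X] {K : Set X} (x : X) (hK : IsClosed K) (hc : IsConnected K) :
    IsPreconnected (connectedComponentIn Kᶜ x)ᶜ := by
  simpa using isPreconnected_compl_connectedComponentIn_inter (x := x) hK isOpen_univ isOpen_empty
    (disjoint_empty _) (by simp) (by simpa using hc)

theorem card_connectedComponents_eq_two {A B O₁ O₂ : Set X} (hA : IsConnected A)
    (hB : IsConnected B) (hO₁ : IsOpen O₁) (hO₂ : IsOpen O₂) (hO : Disjoint O₁ O₂)
    (hAO : A ⊆ O₁) (hBO : B ⊆ O₂) : Nat.card (ConnectedComponents ↥(A ∪ B)) = 2 := by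
  obtain ⟨⟨a, ha⟩, hA⟩ := hA
  obtain ⟨⟨b, hb⟩, hB⟩ := hB
  have hsub : ∀ {S : Set X}, IsPreconnected S → S ⊆ A ∪ B →
      ∀ {x y : ↥(A ∪ B)}, (x : X) ∈ S → (y : X) ∈ S →
        (x : ConnectedComponents ↥(A ∪ B)) = y := by
    intro S hS hSs x y hx hy
    rw [ConnectedComponents.coe_eq_coe']
    have h1 : IsPreconnected (Subtype.val ⁻¹' S : Set ↥(A ∪ B)) := by
      rw [← IsInducing.subtypeVal.isPreconnected_image, Subtype.image_preimage_coe,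
        inter_eq_right.2 hSs]
      exact hS
    exact h1.subset_connectedComponent hy hx
  rw [Nat.card_eq_two_iff]
  refine ⟨((⟨a, Or.inl ha⟩ : ↥(A ∪ B)) : ConnectedComponents ↥(A ∪ B)),
    ((⟨b, Or.inr hb⟩ : ↥(A ∪ B)) : ConnectedComponents ↥(A ∪ B)), fun h => ?_, ?_⟩
  · rw [ConnectedComponents.coe_eq_coe'] at h
    have h1 := (isPreconnected_connectedComponent (x := (⟨b, Or.inr hb⟩ : ↥(A ∪ B)))).image
      Subtype.val continuous_subtype_val.continuousOn
    have h2 := h1.subset_left_of_subset_union hO₁ hO₂ hO (by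
      rintro _ ⟨y, -, rfl⟩
      exact y.2.imp (fun h => hAO h) (fun h => hBO h)) ⟨a, mem_image_of_mem Subtype.val h, hAO ha⟩
    exact disjoint_left.1 hO (h2 (mem_image_of_mem Subtype.val mem_connectedComponent)) (hBO hb)
  · refine eq_univ_of_forall fun c => ?_
    obtain ⟨y, rfl⟩ := ConnectedComponents.surjective_coe c
    rcases y.2 with h | h
    · exact Or.inl (hsub hA subset_union_left h ha)
    · exact Or.inr (hsub hB subset_union_right h hb)

end Components

/-! ### Unicoherence of the plane -/

section Unicoherence

open Complex

/-- Two continuous logarithms of one function differ by a map into the discrete group `2πiℤ`, which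
is constant on a connected set. -/
theorem sub_eq_sub_of_exp_eq {S : Set ℂ} (hS : IsPreconnected S) {F G : ℂ → ℂ}
    (hF : ContinuousOn F S) (hG : ContinuousOn G S) (h : ∀ x ∈ S, exp (F x) = exp (G x)) {a b : ℂ}
    (ha : a ∈ S) (hb : b ∈ S) : F a - G a = F b - G b := by
  have : DiscreteTopology (AddSubgroup.zmultiples (2 * Real.pi * I) : Set ℂ) :=
    NormedSpace.discreteTopology_zmultiples _
  refine hS.constant_of_mapsTo (T := (AddSubgroup.zmultiples (2 * Real.pi * I) : Set ℂ))
    ⟨this⟩ (hF.sub hG) (fun x hx => ?_) ha hb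
  obtain ⟨n, hn⟩ := exp_eq_exp_iff_exists_int.1 (h x hx)
  refine AddSubgroup.mem_zmultiples_iff.2 ⟨n, ?_⟩
  rw [zsmul_eq_mul, Pi.sub_apply, hn]
  ring

/-- The plane is unicoherent. -/
theorem isPreconnected_inter_of_union_eq_univ {P Q : Set ℂ} (hP : IsClosed P) (hQ : IsClosed Q)
    (hPc : IsPreconnected P) (hQc : IsPreconnected Q) (hPQ : P ∪ Q = univ) :
    IsPreconnected (P ∩ Q) := by
  rw [isPreconnected_closed_iff]
  rintro t t' ht ht' hcov ⟨a, haPQ, hat⟩ ⟨b, hbPQ, hbt⟩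
  by_contra hcon
  have hdisj : Disjoint (P ∩ Q ∩ t) (P ∩ Q ∩ t') :=
    disjoint_left.2 fun x hx hx' => hcon ⟨x, hx.1, hx.2, hx'.2⟩
  -- If `P ∩ Q` splits, let `φ` be `0` on one part and `1` on the other, and glue `exp (πiφ)` on `P`
  -- with `exp (-πiφ)` on `Q`. A logarithm of the glued function on the plane would change by `πi`
  -- from `a` to `b` when compared along `P`, and by `-πi` along `Q`.
  obtain ⟨φ, hφ0, hφ1, -⟩ := exists_continuous_zero_one_of_isClosed ((hP.inter hQ).inter ht)
    ((hP.inter hQ).inter ht') hdisj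
  have hα : Continuous fun x => Real.pi * I * φ x := by fun_prop
  have hβ : Continuous fun x => -(Real.pi * I * φ x) := by fun_prop
  have hagree : ∀ x ∈ P ∩ Q, exp (Real.pi * I * φ x) = exp (-(Real.pi * I * φ x)) := by
    intro x hx
    rcases hcov hx with h | h
    · simp [hφ0 ⟨hx, h⟩]
    · simp [hφ1 ⟨hx, h⟩, exp_neg]
  classical
  let u : ℂ → ℂ := P.piecewise (fun x => exp (Real.pi * I * φ x))
    (fun x => exp (-(Real.pi * I * φ x)))
  have hu : Continuous u := by
    refine Continuous.piecewise (fun x hx => hagree x ⟨hP.frontier_subset hx, ?_⟩)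
      (continuous_exp.comp hα) (continuous_exp.comp hβ)
    rw [← frontier_compl] at hx
    refine closure_minimal (fun y hy => ?_) hQ (frontier_subset_closure hx)
    exact (hPQ ▸ mem_univ y : y ∈ P ∪ Q).resolve_left hy
  have huP : ∀ x ∈ P, u x = exp (Real.pi * I * φ x) := fun x hx => piecewise_eq_of_mem _ _ _ hx
  have huQ : ∀ x ∈ Q, u x = exp (-(Real.pi * I * φ x)) := by
    intro x hx
    by_cases hxP : x ∈ P
    · rw [huP x hxP, hagree x ⟨hxP, hx⟩]
    · exact piecewise_eq_of_notMem _ _ _ hxP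
  have hu0 : ∀ x, u x ∈ ({0}ᶜ : Set ℂ) := by
    intro x
    rcases (hPQ ▸ mem_univ x : x ∈ P ∪ Q) with h | h
    · rw [huP x h]; exact exp_ne_zero _
    · rw [huQ x h]; exact exp_ne_zero _
  obtain ⟨F, ⟨-, hF⟩, -⟩ := isCoveringMapOn_exp.existsUnique_continuousMap_lifts
    (⟨u, hu⟩ : C(ℂ, ℂ)) (a₀ := 0) (e₀ := log (u 0)) (exp_log (hu0 0)) hu0
  have hFu : ∀ x, exp (F x) = u x := fun x => congrFun hF x
  have h1 := sub_eq_sub_of_exp_eq hPc F.continuous.continuousOn hα.continuousOn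
    (fun x hx => (hFu x).trans (huP x hx)) haPQ.1 hbPQ.1
  have h2 := sub_eq_sub_of_exp_eq hQc F.continuous.continuousOn hβ.continuousOn
    (fun x hx => (hFu x).trans (huQ x hx)) haPQ.2 hbPQ.2
  have h3 : φ a = 0 := hφ0 ⟨haPQ, hat⟩
  have h4 : φ b = 1 := hφ1 ⟨hbPQ, hbt⟩
  rw [h3, h4] at h1 h2
  have h5 : (Real.pi * I : ℂ) = 0 := by
    push_cast at h1 h2
    linear_combination (h1 - h2) / 2
  simp [Real.pi_ne_zero] at h5

/-- The boundary of a component of the exterior of a connected plane set is connected. -/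
theorem isPreconnected_frontier_connectedComponentIn {D : Set ℂ} (hD : IsConnected D) (x : ℂ) :
    IsPreconnected (frontier (connectedComponentIn (closure D)ᶜ x)) := by
  have ho : IsOpen (connectedComponentIn (closure D)ᶜ x) :=
    isClosed_closure.isOpen_compl.connectedComponentIn
  rw [ho.frontier_eq, sdiff_eq]
  -- The boundary is the intersection of the closure of the component with its complement: two
  -- closed connected sets covering the plane.
  refine isPreconnected_inter_of_union_eq_univ isClosed_closure ho.isClosed_compl
    isPreconnected_connectedComponentIn.closure
    (isPreconnected_compl_connectedComponentIn x isClosed_closure hD.closure) ?_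
  exact eq_univ_of_forall fun y =>
    (em (y ∈ connectedComponentIn (closure D)ᶜ x)).imp (fun h => subset_closure h) id

end Unicoherence

/-! ### Annular domains and the filling of their holes -/

section Annuli

open Metric Complex

/-- The closed annulus with radii `R⁻¹` and `R`. -/
def closedAnnulus (R : ℝ) : Set ℂ := {z | R⁻¹ ≤ ‖z‖ ∧ ‖z‖ ≤ R}

theorem closedAnnulus_subset_Cstar {R : ℝ} (hR : 0 < R) : closedAnnulus R ⊆ Cstar := by
  rintro z ⟨hz, -⟩ h0
  rw [mem_singleton_iff] at h0
  rw [h0, norm_zero] at hz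
  exact (inv_pos.2 hR).not_ge hz

theorem isCompact_closedAnnulus (R : ℝ) : IsCompact (closedAnnulus R) := by
  refine (isCompact_closedBall (0 : ℂ) R).of_isClosed_subset ?_ fun z hz =>
    mem_closedBall_zero_iff.2 hz.2
  exact (isClosed_le continuous_const continuous_norm).inter
    (isClosed_le continuous_norm continuous_const)

theorem closedAnnulus_mono {R S : ℝ} (hR : 0 < R) (h : R ≤ S) :
    closedAnnulus R ⊆ closedAnnulus S :=
  fun _ hz => ⟨(inv_anti₀ hR h).trans hz.1, hz.2.trans h⟩

theorem exists_mem_closedAnnulus {z : ℂ} (hz : z ∈ Cstar) : ∃ R > 1, z ∈ closedAnnulus R := by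
  have hz0 : 0 < ‖z‖ := norm_pos_iff.2 hz
  refine ⟨max 2 (max ‖z‖ ‖z‖⁻¹), lt_max_of_lt_left one_lt_two, ?_, by simp⟩
  exact inv_le_of_inv_le₀ hz0 (by simp)

theorem isPreconnected_closedAnnulus {R : ℝ} (hR : 0 < R) : IsPreconnected (closedAnnulus R) := by
  have h : closedAnnulus R = exp '' (re ⁻¹' Icc (-Real.log R) (Real.log R)) := by
    ext z
    constructor
    · rintro hz
      have hz0 : z ≠ 0 := closedAnnulus_subset_Cstar hR hz
      have hzn : 0 < ‖z‖ := norm_pos_iff.2 hz0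
      refine ⟨log z, ⟨?_, ?_⟩, exp_log hz0⟩
      · rw [log_re, ← Real.log_inv]
        exact Real.log_le_log (inv_pos.2 hR) hz.1
      · rw [log_re]
        exact Real.log_le_log hzn hz.2
    · rintro ⟨w, ⟨h1, h2⟩, rfl⟩
      rw [← Real.log_inv, Real.log_le_iff_le_exp (inv_pos.2 hR)] at h1
      rw [Real.le_log_iff_exp_le hR] at h2
      exact ⟨by rwa [norm_exp], by rwa [norm_exp]⟩
  rw [h]
  exact ((convex_Icc _ _).linear_preimage reLm).isPreconnected.image _ continuous_exp.continuousOn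

theorem isPreconnected_setOf_lt_norm {r : ℝ} (hr : 0 < r) : IsPreconnected {z : ℂ | r < ‖z‖} := by
  have h : {z : ℂ | r < ‖z‖} = exp '' (re ⁻¹' Ioi (Real.log r)) := by
    ext z
    constructor
    · intro hz
      have hz0 : z ≠ 0 := norm_pos_iff.1 (hr.trans hz)
      exact ⟨log z, by rw [mem_preimage, log_re]; exact Real.log_lt_log hr hz, exp_log hz0⟩
    · rintro ⟨w, hw, rfl⟩
      rw [mem_preimage, mem_Ioi, Real.log_lt_iff_lt_exp hr] at hw
      rwa [mem_ofPred_eq, norm_exp]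
  rw [h]
  exact ((convex_Ioi _).linear_preimage reLm).isPreconnected.image _ continuous_exp.continuousOn

theorem isClosed_toSphere {A : Set ℂ} (hA : IsCompact A) : IsClosed (toSphere A) :=
  (hA.image OnePoint.continuous_coe).isClosed

theorem isOpen_toSphere {A : Set ℂ} (hA : IsOpen A) : IsOpen (toSphere A) :=
  OnePoint.isOpenEmbedding_coe.isOpenMap _ hA

theorem coe_mem_toSphere {A : Set ℂ} {z : ℂ} : (z : Sphere) ∈ toSphere A ↔ z ∈ A :=
  OnePoint.coe_injective.mem_set_image

theorem infty_notMem_toSphere {A : Set ℂ} : OnePoint.infty ∉ toSphere A := by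
  rintro ⟨z, -, h⟩
  exact OnePoint.coe_ne_infty z h

theorem isBoundedInCstar_of_subset {A : Set ℂ} {R : ℝ} (hR : 0 < R) (hA : A ⊆ closedAnnulus R) :
    IsBoundedInCstar A := by
  have h : closure (toSphere A) ⊆ toSphere (closedAnnulus R) :=
    closure_minimal (image_mono hA) (isClosed_toSphere (isCompact_closedAnnulus R))
  refine disjoint_left.2 fun x hx hx' => ?_
  rcases hx' with rfl | rfl
  · exact closedAnnulus_subset_Cstar hR (coe_mem_toSphere.1 (h hx)) rfl
  · exact infty_notMem_toSphere (h hx)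

/-- The data attached to an annular domain: the components of its exterior that contain `0` and
a neighbourhood of infinity, and a doubly connected domain bounded by their boundaries. -/
structure IsAnnularFilling (D : Set ℂ) (R : ℝ) (W V G : Set ℂ) : Prop where
  isOpen_inner : IsOpen W
  zero_mem_inner : 0 ∈ W
  inner_subset : W ⊆ ball 0 R⁻¹
  isPreconnected_frontier_inner : IsPreconnected (frontier W)
  frontier_inner_subset : frontier W ⊆ frontier D
  isOpen_outer : IsOpen V
  exists_mem_outer : ∃ r, ∀ z : ℂ, r < ‖z‖ → z ∈ V
  outer_subset : V ⊆ {z | R < ‖z‖}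
  isPreconnected_frontier_outer : IsPreconnected (frontier V)
  frontier_outer_subset : frontier V ⊆ frontier D
  isDomain : IsDomainInPlane G
  isBounded : IsBoundedInCstar G
  exists_subset : ∃ R', G ⊆ closedAnnulus R'
  isDoublyConnected : IsDoublyConnected G
  separates : Separates (toSphere G) {((0 : ℂ) : Sphere)} {OnePoint.infty}
  subset_domain : closedAnnulus R ⊆ G
  frontier_subset : frontier G ⊆ frontier W ∪ frontier V

theorem separates_of_sphere_subset {G : Set ℂ} (hG : sphere 0 1 ⊆ G) :
    Separates (toSphere G) {((0 : ℂ) : Sphere)} {OnePoint.infty} := by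
  have hcl : closure (toSphere (ball 0 1)) ⊆ toSphere (closedBall 0 1) :=
    closure_minimal (image_mono ball_subset_closedBall)
      (isClosed_toSphere (isCompact_closedBall 0 1))
  have ho : IsOpen (toSphere (ball 0 1)) := isOpen_toSphere isOpen_ball
  refine ⟨toSphere (ball 0 1), ho, ?_, ?_, ?_⟩
  · rw [singleton_subset_iff]
    exact coe_mem_toSphere.2 (mem_ball_self one_pos)
  · exact disjoint_singleton_right.2 fun h => infty_notMem_toSphere (hcl h)
  · rw [ho.frontier_eq]
    rintro _ ⟨hx, hx'⟩
    obtain ⟨z, hz, rfl⟩ := hcl hx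
    refine coe_mem_toSphere.2 (hG ?_)
    rw [mem_closedBall_zero_iff] at hz
    rw [mem_sphere_zero_iff_norm]
    refine hz.antisymm (not_lt.1 fun h => hx' (coe_mem_toSphere.2 ?_))
    rwa [mem_ball_zero_iff]

/-- The unit circle cuts the complement of `G` in two. The outer part accumulates at infinity, so
adding the point at infinity keeps it connected. -/
theorem isDoublyConnected_of_isPreconnected {G : Set ℂ} {r : ℝ} (hsph : sphere 0 1 ⊆ G)
    (h0 : 0 ∉ G) (hr : ∀ z : ℂ, r < ‖z‖ → z ∉ G) (hin : IsPreconnected (Gᶜ ∩ ball 0 1))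
    (hout : IsPreconnected (Gᶜ ∩ {z | 1 < ‖z‖})) : IsDoublyConnected G := by
  have hcompl : (toSphere G)ᶜ = toSphere (Gᶜ ∩ ball 0 1) ∪
      insert OnePoint.infty (toSphere (Gᶜ ∩ {z | 1 < ‖z‖})) := by
    ext x
    induction x using OnePoint.rec with
    | infty => simp [infty_notMem_toSphere]
    | coe z =>
      simp only [mem_compl_iff, mem_union, mem_insert_iff, OnePoint.coe_ne_infty, false_or,
        coe_mem_toSphere, mem_inter_iff, mem_ball_zero_iff, mem_ofPred_eq, ← and_or_left,
        iff_self_and]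
      intro hz
      rcases lt_trichotomy ‖z‖ 1 with h | h | h
      · exact Or.inl h
      · exact absurd (hsph (mem_sphere_zero_iff_norm.2 h)) hz
      · exact Or.inr h
  have hclosed : IsClosed (toSphere (closedBall 0 1)) :=
    isClosed_toSphere (isCompact_closedBall 0 1)
  have hinfty : OnePoint.infty ∈ closure (toSphere (Gᶜ ∩ {z | 1 < ‖z‖})) := by
    refine mem_closure_of_tendsto tendsto_coe_sphere_cobounded ?_
    filter_upwards [tendsto_norm_cobounded_atTop.eventually_gt_atTop r,
      tendsto_norm_cobounded_atTop.eventually_gt_atTop 1] with z hz hz1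
    exact coe_mem_toSphere.2 ⟨hr z hz, hz1⟩
  unfold IsDoublyConnected
  rw [hcompl]
  refine card_connectedComponents_eq_two
    ⟨⟨((0 : ℂ) : Sphere), coe_mem_toSphere.2 ⟨h0, mem_ball_self one_pos⟩⟩,
      hin.image _ OnePoint.continuous_coe.continuousOn⟩
    ⟨⟨OnePoint.infty, mem_insert _ _⟩,
      (hout.image _ OnePoint.continuous_coe.continuousOn).subset_closure (subset_insert _ _)
        (insert_subset hinfty subset_closure)⟩
    (isOpen_toSphere (isOpen_ball (x := 0) (ε := 1))) hclosed.isOpen_compl ?_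
    (image_mono inter_subset_right) ?_
  · exact disjoint_compl_right.mono_left (image_mono ball_subset_closedBall)
  · rw [insert_subset_iff]
    refine ⟨infty_notMem_toSphere, ?_⟩
    rintro _ ⟨z, hz, rfl⟩ h
    have := mem_closedBall_zero_iff.1 (coe_mem_toSphere.1 h)
    exact not_lt.2 this hz.2

/-- All holes of `D` other than `W` and `V` are filled by passing to the component of the complement
of `K = closure W ∪ closure V`. Since the parts of `K` inside and outside the unit circle are the
connected sets `closure W` and `closure V`, the complement of `G` has a connected part on each side.
-/
theorem exists_isAnnularFilling {D : Set ℂ} {R : ℝ} (hR : 1 < R) (hDo : IsOpen D)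
    (hDc : IsPreconnected D) (hRD : closedAnnulus R ⊆ D) (hcomp : IsCompact (closure D))
    (hDC : closure D ⊆ Cstar) : ∃ W V G, IsAnnularFilling D R W V G := by
  have hR0 : 0 < R := one_pos.trans hR
  have hRinv : R⁻¹ < 1 := inv_lt_one_of_one_lt₀ hR
  have hsph : sphere (0 : ℂ) 1 ⊆ closedAnnulus R := by
    intro z hz
    rw [mem_sphere_zero_iff_norm] at hz
    exact ⟨hz ▸ hRinv.le, hz ▸ hR.le⟩
  have h1A : (1 : ℂ) ∈ closedAnnulus R := hsph (by simp)
  have hDconn : IsConnected D := ⟨⟨1, hRD h1A⟩, hDc⟩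
  obtain ⟨r, hrR, hDr⟩ : ∃ r, R < r ∧ closure D ⊆ ball 0 r := by
    obtain ⟨r, hr⟩ := (isBounded_iff_subset_ball (0 : ℂ)).1 hcomp.isBounded
    exact ⟨max r (R + 1), lt_max_of_lt_right (lt_add_one R),
      hr.trans (ball_subset_ball (le_max_left _ _))⟩
  have hr0 : 0 < r := hR0.trans hrR
  have hopen : IsOpen (closure D)ᶜ := isClosed_closure.isOpen_compl
  have h0D : (0 : ℂ) ∈ (closure D)ᶜ := fun h => hDC h rfl
  -- a connected subset of the exterior lies inside or outside the annulus
  have hO₁ : IsOpen (ball (0 : ℂ) R⁻¹) := isOpen_ball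
  have hO₂ : IsOpen {z : ℂ | R < ‖z‖} := isOpen_lt continuous_const continuous_norm
  have hO : Disjoint (ball (0 : ℂ) R⁻¹) {z : ℂ | R < ‖z‖} := disjoint_left.2 fun z hz hz' => by
    rw [mem_ball_zero_iff] at hz
    rw [mem_ofPred_eq] at hz'
    linarith
  have hext : (closure D)ᶜ ⊆ ball 0 R⁻¹ ∪ {z : ℂ | R < ‖z‖} := by
    intro z hz
    by_contra hcon
    rw [mem_union, not_or, mem_ball_zero_iff, mem_ofPred_eq, not_lt, not_lt] at hcon
    exact hz (subset_closure (hRD hcon))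
  set W := connectedComponentIn (closure D)ᶜ (0 : ℂ) with hWdef
  have hWsub : W ⊆ (closure D)ᶜ := connectedComponentIn_subset _ _
  have h0W : 0 ∈ W := mem_connectedComponentIn h0D
  have hWball : W ⊆ ball 0 R⁻¹ := isPreconnected_connectedComponentIn.subset_left_of_subset_union
    hO₁ hO₂ hO (hWsub.trans hext) ⟨0, h0W, mem_ball_self (inv_pos.2 hR0)⟩
  have hrball : {z : ℂ | r < ‖z‖} ⊆ (closure D)ᶜ := fun z hz hzD =>
    lt_asymm hz (mem_ball_zero_iff.1 (hDr hzD))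
  have hx : ((r + 1 : ℝ) : ℂ) ∈ {z : ℂ | r < ‖z‖} := by
    rw [mem_ofPred_eq, norm_real, Real.norm_eq_abs, abs_of_pos (by linarith)]
    linarith
  set V := connectedComponentIn (closure D)ᶜ ((r + 1 : ℝ) : ℂ) with hVdef
  have hVsub : V ⊆ (closure D)ᶜ := connectedComponentIn_subset _ _
  have hVr : {z : ℂ | r < ‖z‖} ⊆ V :=
    (isPreconnected_setOf_lt_norm hr0).subset_connectedComponentIn hx hrball
  have hVout : V ⊆ {z | R < ‖z‖} :=
    isPreconnected_connectedComponentIn.subset_right_of_subset_union hO₁ hO₂ hO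
      (hVsub.trans hext) ⟨_, hVr hx, hrR.trans hx⟩
  have hWo : IsOpen W := hopen.connectedComponentIn
  have hVo : IsOpen V := hopen.connectedComponentIn
  have hWfr : frontier W ⊆ frontier D := (frontier_connectedComponentIn_subset hopen _).trans
    (by rw [frontier_compl]; exact frontier_closure_subset)
  have hVfr : frontier V ⊆ frontier D := (frontier_connectedComponentIn_subset hopen _).trans
    (by rw [frontier_compl]; exact frontier_closure_subset)
  set K := closure W ∪ closure V with hKdef
  have hK : IsClosed K := isClosed_closure.union isClosed_closure
  have hDK : D ⊆ Kᶜ := by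
    have h : K ⊆ Dᶜ := union_subset
      (closure_minimal (fun z hz hzD => hWsub hz (subset_closure hzD)) hDo.isClosed_compl)
      (closure_minimal (fun z hz hzD => hVsub hz (subset_closure hzD)) hDo.isClosed_compl)
    exact fun z hz hzK => h hzK hz
  set G := connectedComponentIn Kᶜ (1 : ℂ) with hGdef
  have hGK : G ⊆ Kᶜ := connectedComponentIn_subset _ _
  have hAG : closedAnnulus R ⊆ G :=
    (isPreconnected_closedAnnulus hR0).subset_connectedComponentIn h1A (hRD.trans hDK)
  have h0G : 0 ∉ G := fun h => hGK h (Or.inl (subset_closure h0W))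
  have hrG : ∀ z : ℂ, r < ‖z‖ → z ∉ G := fun z hz h => hGK h (Or.inr (subset_closure (hVr hz)))
  obtain ⟨R', hR', hGR'⟩ : ∃ R' > 0, G ⊆ closedAnnulus R' := by
    obtain ⟨ε, hε, hεW⟩ := Metric.isOpen_iff.1 hWo 0 h0W
    refine ⟨max r ε⁻¹, lt_max_of_lt_left hr0, fun z hz => ⟨?_, ?_⟩⟩
    · refine (inv_le_of_inv_le₀ hε (le_max_right _ _)).trans (not_lt.1 fun h => ?_)
      exact hGK hz (Or.inl (subset_closure (hεW (mem_ball_zero_iff.2 h))))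
    · exact (not_lt.1 fun h => hrG z h hz).trans (le_max_left _ _)
  have hclW : closure W ⊆ ball 0 1 :=
    (closure_minimal (hWball.trans ball_subset_closedBall) isClosed_closedBall).trans
      (closedBall_subset_ball hRinv)
  have hclV : closure V ⊆ {z | 1 < ‖z‖} :=
    (closure_minimal (t := {z : ℂ | R ≤ ‖z‖}) (fun z hz => show R ≤ ‖z‖ from le_of_lt (hVout hz))
      (isClosed_le continuous_const continuous_norm)).trans fun z hz => hR.trans_le hz
  have hdisj : Disjoint (ball (0 : ℂ) 1) {z : ℂ | 1 < ‖z‖} := disjoint_left.2 fun z hz hz' =>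
    lt_asymm (mem_ball_zero_iff.1 hz) hz'
  have hop : IsOpen {z : ℂ | 1 < ‖z‖} := isOpen_lt continuous_const continuous_norm
  have hcov : Gᶜ ⊆ ball 0 1 ∪ {z : ℂ | 1 < ‖z‖} := by
    intro z hz
    rcases lt_trichotomy ‖z‖ 1 with h | h | h
    · exact Or.inl (mem_ball_zero_iff.2 h)
    · exact absurd (hAG (hsph (mem_sphere_zero_iff_norm.2 h))) hz
    · exact Or.inr h
  have hKin : K ∩ ball 0 1 = closure W := by
    rw [hKdef, union_inter_distrib_right, inter_eq_left.2 hclW,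
      (hdisj.symm.mono_left hclV).inter_eq, union_empty]
  have hKout : K ∩ {z | 1 < ‖z‖} = closure V := by
    rw [hKdef, union_inter_distrib_right, inter_eq_left.2 hclV,
      (hdisj.mono_left hclW).inter_eq, empty_union]
  have hWconn : IsConnected W := ⟨⟨0, h0W⟩, isPreconnected_connectedComponentIn⟩
  have hVconn : IsConnected V := ⟨⟨_, hVr hx⟩, isPreconnected_connectedComponentIn⟩
  exact ⟨W, V, G,
    { isOpen_inner := hWo
      zero_mem_inner := h0W
      inner_subset := hWball
      isPreconnected_frontier_inner := isPreconnected_frontier_connectedComponentIn hDconn _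
      frontier_inner_subset := hWfr
      isOpen_outer := hVo
      exists_mem_outer := ⟨r, fun z hz => hVr hz⟩
      outer_subset := hVout
      isPreconnected_frontier_outer := isPreconnected_frontier_connectedComponentIn hDconn _
      frontier_outer_subset := hVfr
      isDomain := ⟨hK.isOpen_compl.connectedComponentIn, ⟨1, hAG h1A⟩,
        isPreconnected_connectedComponentIn⟩
      isBounded := isBoundedInCstar_of_subset hR' hGR'
      exists_subset := ⟨R', hGR'⟩
      isDoublyConnected := isDoublyConnected_of_isPreconnected (hsph.trans hAG) h0G hrG
        (isPreconnected_compl_connectedComponentIn_inter hK isOpen_ball hop hdisj hcov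
          (by rw [hKin]; exact hWconn.closure))
        (isPreconnected_compl_connectedComponentIn_inter hK hop isOpen_ball hdisj.symm
          (by rw [union_comm]; exact hcov) (by rw [hKout]; exact hVconn.closure))
      separates := separates_of_sphere_subset (hsph.trans hAG)
      subset_domain := hAG
      frontier_subset := by
        refine (frontier_connectedComponentIn_subset hK.isOpen_compl _).trans ?_
        rw [frontier_compl]
        refine (frontier_union_subset _ _).trans (union_subset_union ?_ ?_)
        · exact inter_subset_left.trans frontier_closure_subset
        · exact inter_subset_right.trans frontier_closure_subset }⟩

end Annuli

/-! ### Building the web from images of boundary curves -/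

section SpidersWeb

open Metric Complex

theorem IsPreconnected.inter_frontier_nonempty {X : Type*} [TopologicalSpace X] {S A : Set X}
    (hS : IsPreconnected S) (hA : IsOpen A) (h : (S ∩ A).Nonempty) (h' : (S ∩ Aᶜ).Nonempty) :
    (S ∩ frontier A).Nonempty := by
  by_contra hcon
  have hsub : S ⊆ A ∪ (closure A)ᶜ := by
    intro x hx
    by_contra hxA
    rw [mem_union, not_or, notMem_compl_iff] at hxA
    exact hcon ⟨x, hx, hA.frontier_eq ▸ ⟨hxA.2, hxA.1⟩⟩
  obtain ⟨x, hx, hxA⟩ := h'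
  exact hxA (hS.subset_left_of_subset_union hA isClosed_closure.isOpen_compl
    (disjoint_compl_right.mono_left subset_closure) hsub h hx)

variable {f : ℂ → ℂ}

theorem IsTranscendentalSelfMapCstar.not_meromorphicAt_inv (hf : IsTranscendentalSelfMapCstar f) :
    ¬ MeromorphicAt f⁻¹ 0 := fun h => hf.essential_zero (by simpa using h.inv)

/-- Otherwise the singularity would be removable by the maximum principle. Arbitrary neighbourhoods
are needed in place of discs because `W` is only known to be open. -/
theorem exists_lt_norm_on_frontier {h : ℂ → ℂ} (hh : DifferentiableOn ℂ h Cstar)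
    (hm : ¬ MeromorphicAt h 0) (C : ℝ) :
    ∃ ε > 0, ∀ W : Set ℂ, IsOpen W → 0 ∈ W → W ⊆ ball 0 ε → ∃ z ∈ frontier W, C < ‖h z‖ := by
  by_contra! hcon
  exact hm (meromorphicAt_zero_of_frontier_bound (C := C) one_pos (hh.mono fun z hz => hz.2) hcon)

/-- The image of the boundary of a small neighbourhood of `0` contains points close to `0` and
points close to infinity. -/
theorem IsTranscendentalSelfMapCstar.exists_small_large_on_frontier
    (hf : IsTranscendentalSelfMapCstar f) {ε : ℝ} (hε : 0 < ε) :
    ∃ R₀ : ℝ, ∀ R ≥ R₀, ∀ W : Set ℂ, IsOpen W → 0 ∈ W → W ⊆ ball 0 R⁻¹ →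
      (∃ z ∈ frontier W, ‖f z‖ < ε) ∧ ∃ z ∈ frontier W, ε⁻¹ < ‖f z‖ := by
  obtain ⟨ε₁, hε₁, h₁⟩ := exists_lt_norm_on_frontier hf.differentiableOn hf.essential_zero ε⁻¹
  -- Small values of `f` are large values of `1 / f`, which is holomorphic and essentially singular
  -- too.
  obtain ⟨ε₂, hε₂, h₂⟩ := exists_lt_norm_on_frontier
    (hf.differentiableOn.inv fun z hz => hf.mapsTo hz) hf.not_meromorphicAt_inv ε⁻¹
  refine ⟨max ε₁⁻¹ ε₂⁻¹, fun R hR W hW h0 hWs => ⟨?_, ?_⟩⟩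
  · obtain ⟨z, hz, hzf⟩ := h₂ W hW h0 (hWs.trans (ball_subset_ball
      (inv_le_of_inv_le₀ hε₂ ((le_max_right _ _).trans hR))))
    refine ⟨z, hz, ?_⟩
    have hz0 : f z ≠ 0 := hf.mapsTo fun hz0 => by
      rw [mem_singleton_iff] at hz0
      rw [hW.frontier_eq, hz0] at hz
      exact hz.2 h0
    rw [Pi.inv_apply, norm_inv] at hzf
    exact (inv_lt_inv₀ hε (norm_pos_iff.2 hz0)).1 hzf
  · exact h₁ W hW h0 (hWs.trans (ball_subset_ball
      (inv_le_of_inv_le₀ hε₁ ((le_max_left _ _).trans hR))))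

/-- By Picard's theorem `f` is onto the punctured plane, so no iterate is constant and the open
mapping theorem applies. -/
theorem IsTranscendentalSelfMapCstar.isOpen_image_iterate (hf : IsTranscendentalSelfMapCstar f)
    (n : ℕ) {U : Set ℂ} (hU : IsOpen U) (hUC : U ⊆ Cstar) : IsOpen (f^[n] '' U) := by
  have hsurj : SurjOn f Cstar Cstar := by
    intro b hb
    obtain ⟨z, hz, hz0⟩ := ((hf.frequently_eq hb).and_eventually self_mem_nhdsWithin).exists
    exact ⟨z, hz0, hz⟩
  have hsn := hsurj.iterate n
  rcases ((hf.differentiableOn_iterate n).analyticOnNhd isOpen_Cstar).is_constant_or_isOpen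
    isPreconnected_Cstar with ⟨w, hw⟩ | h
  · obtain ⟨x, hx, hx1⟩ := hsn (show (1 : ℂ) ∈ Cstar from one_ne_zero)
    obtain ⟨y, hy, hy2⟩ := hsn (show (2 : ℂ) ∈ Cstar from two_ne_zero)
    rw [hw x hx] at hx1
    rw [hw y hy, hx1] at hy2
    norm_num at hy2
  · exact h U hUC hU

/-- If a point of the Julia set lies in a bounded open set whose boundary lies in a forward
invariant set `X`, then there are arbitrarily large annular domains with boundary in `X`. -/
theorem IsTranscendentalSelfMapCstar.exists_domain_frontier_subset
    (hf : IsTranscendentalSelfMapCstar f) {X : Set ℂ} (hinv : MapsTo f X X) {z : ℂ}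
    (hz : z ∈ juliaSet f) {U : Set ℂ} (hU : IsOpen U) (hzU : z ∈ U) (hUc : IsCompact (closure U))
    (hUC : closure U ⊆ Cstar) (hUX : frontier U ⊆ X) {R : ℝ} (hR : 1 < R) :
    ∃ D : Set ℂ, IsOpen D ∧ IsPreconnected D ∧ closedAnnulus R ⊆ D ∧ IsCompact (closure D) ∧
      closure D ⊆ Cstar ∧ frontier D ⊆ X := by
  have hR0 : 0 < R := one_pos.trans hR
  have hUC' : U ⊆ Cstar := subset_closure.trans hUC
  obtain ⟨t, ht⟩ := (isCompact_closedAnnulus R).elim_finite_subcover (fun n => f^[n] '' U)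
    (fun n => hf.isOpen_image_iterate n hU hUC') fun b hb =>
      mem_iUnion.2 (hf.exists_mem_image_iterate hz hU hzU hUC' (closedAnnulus_subset_Cstar hR0 hb))
  set D' := ⋃ n ∈ t, f^[n] '' U with hD'
  have hD'o : IsOpen D' :=
    isOpen_biUnion fun n _ => hf.isOpen_image_iterate n hU hUC'
  set K := ⋃ n ∈ t, f^[n] '' closure U with hK
  have hKc : IsCompact K := t.isCompact_biUnion fun n _ =>
    hUc.image_of_continuousOn ((hf.differentiableOn_iterate n).continuousOn.mono hUC)
  have hKC : K ⊆ Cstar := iUnion₂_subset fun n _ =>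
    ((hf.mapsTo.iterate n).mono_left hUC).image_subset
  have hD'K : closure D' ⊆ K :=
    closure_minimal (biUnion_mono subset_rfl fun n _ => image_mono subset_closure) hKc.isClosed
  have h1 : (1 : ℂ) ∈ closedAnnulus R := by
    refine ⟨?_, ?_⟩ <;> rw [norm_one]
    exacts [(inv_lt_one_of_one_lt₀ hR).le, hR.le]
  have hcl : closure (connectedComponentIn D' (1 : ℂ)) ⊆ closure D' :=
    closure_mono (connectedComponentIn_subset _ _)
  refine ⟨connectedComponentIn D' 1, hD'o.connectedComponentIn,
    isPreconnected_connectedComponentIn,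
    (isPreconnected_closedAnnulus hR0).subset_connectedComponentIn h1 ht,
    hKc.of_isClosed_subset isClosed_closure (hcl.trans hD'K), hcl.trans (hD'K.trans hKC),
    (frontier_connectedComponentIn_subset hD'o 1).trans ?_⟩
  -- A boundary point of the union is `f^n x` with `x` in the closure of `U` but not in `U`, as
  -- images of points of `U` are interior. So `x ∈ ∂U ⊆ X`, and `X` is forward invariant.
  intro y hy
  rw [hD'o.frontier_eq] at hy
  obtain ⟨n, hn, x, hx, rfl⟩ := mem_iUnion₂.1 (hD'K hy.1)
  refine hinv.iterate n (hUX ?_)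
  rw [hU.frontier_eq]
  exact ⟨hx, fun hxU => hy.2 (mem_iUnion₂.2 ⟨n, hn, x, hxU, rfl⟩)⟩

theorem IsAnnularFilling.exists_pos {D W V G : Set ℂ} {R : ℝ} (h : IsAnnularFilling D R W V G) :
    ∃ ε > 0, ∀ δ > 0, δ ≤ ε → (∀ z : ℂ, ‖z‖ < δ → z ∈ W) ∧ ∀ z : ℂ, δ⁻¹ < ‖z‖ → z ∈ V := by
  obtain ⟨ε, hε, hεW⟩ := Metric.isOpen_iff.1 h.isOpen_inner 0 h.zero_mem_inner
  obtain ⟨r, hr⟩ := h.exists_mem_outer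
  have hr' : 0 < max r 1 := lt_max_of_lt_right one_pos
  refine ⟨min ε (max r 1)⁻¹, lt_min hε (inv_pos.2 hr'), fun δ hδ hle => ⟨fun z hz => ?_,
    fun z hz => hr z ?_⟩⟩
  · exact hεW (mem_ball_zero_iff.2 (hz.trans_le (hle.trans (min_le_left _ _))))
  · exact ((le_max_left r 1).trans
      (le_inv_of_le_inv₀ hδ (hle.trans (min_le_right _ _)))).trans_lt hz

theorem IsAnnularFilling.disjoint {D W V G : Set ℂ} {R : ℝ} (hR : 1 < R)
    (h : IsAnnularFilling D R W V G) : Disjoint W V := disjoint_left.2 fun z hzW hzV => by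
  have h1 := mem_ball_zero_iff.1 (h.inner_subset hzW)
  have h2 : R < ‖z‖ := h.outer_subset hzV
  linarith [inv_lt_one_of_one_lt₀ hR]

/-- A connected set containing points close to `0` and points close to infinity meets both
boundary components of an annular domain. -/
theorem IsAnnularFilling.inter_frontier_nonempty {D W V G S : Set ℂ} {R : ℝ} (hR : 1 < R)
    (h : IsAnnularFilling D R W V G) (hS : IsPreconnected S) (hW : (S ∩ W).Nonempty)
    (hV : (S ∩ V).Nonempty) : (S ∩ frontier W).Nonempty ∧ (S ∩ frontier V).Nonempty := by
  have hd := h.disjoint hR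
  exact ⟨hS.inter_frontier_nonempty h.isOpen_inner hW
      (hV.mono (inter_subset_inter_right _ hd.symm.subset_compl_right)),
    hS.inter_frontier_nonempty h.isOpen_outer hV
      (hW.mono (inter_subset_inter_right _ hd.subset_compl_right))⟩

theorem exists_isCstarSpidersWeb_subset (hf : IsTranscendentalSelfMapCstar f) {X : Set ℂ}
    (hX : X ⊆ Cstar) (hinv : MapsTo f X X)
    (hD : ∀ R : ℝ, 1 < R → ∃ D W V G, frontier D ⊆ X ∧ IsAnnularFilling D R W V G) :
    ∃ E ⊆ X, IsCstarSpidersWeb E := by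
  choose! D W V G hDX hfill using hD
  have hnext : ∀ R : ℝ, 1 < R → ∃ R', R + 1 ≤ R' ∧ G R ⊆ closedAnnulus R' := by
    intro R hR
    obtain ⟨R', hR'⟩ := (hfill R hR).exists_subset
    have h1 : (1 : ℂ) ∈ G R := (hfill R hR).subset_domain
      ⟨by rw [norm_one]; exact (inv_lt_one_of_one_lt₀ hR).le, by rw [norm_one]; exact hR.le⟩
    have hpos : 0 < R' := one_pos.trans_le (by simpa using (hR' h1).2)
    exact ⟨max R' (R + 1), le_max_right _ _, hR'.trans (closedAnnulus_mono hpos (le_max_left _ _))⟩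
  -- Radii are chosen recursively, so that each annulus contains the preceding filled domain; growth
  -- by at least `1` makes them exhaust the punctured plane.
  choose! nx hnx hnxG using hnext
  let r : ℕ → ℝ := fun n => nx^[n] 2
  have hr_succ : ∀ n, r (n + 1) = nx (r n) := fun n => Function.iterate_succ_apply' nx n 2
  have hr_ge : ∀ n : ℕ, (n : ℝ) + 2 ≤ r n := by
    intro n
    induction n with
    | zero => simp [r]
    | succ n ih =>
      have : (0 : ℝ) ≤ n := n.cast_nonneg
      rw [hr_succ]
      push_cast
      linarith [hnx (r n) (by linarith)]
  have hr1 : ∀ n, 1 < r n := fun n => by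
    have : (0 : ℝ) ≤ n := n.cast_nonneg
    linarith [hr_ge n]
  have F : ∀ n, IsAnnularFilling (D (r n)) (r n) (W (r n)) (V (r n)) (G (r n)) := fun n =>
    hfill _ (hr1 n)
  -- the image of an inner boundary curve crosses any two given annular domains
  have hcross : ∀ n, ∃ k, ∀ m ∈ ({0, n} : Set ℕ),
      (f '' frontier (W (r k)) ∩ frontier (W (r m))).Nonempty ∧
      (f '' frontier (W (r k)) ∩ frontier (V (r m))).Nonempty := by
    intro n
    obtain ⟨ε₀, hε₀, h₀⟩ := (F 0).exists_pos
    obtain ⟨ε₁, hε₁, h₁⟩ := (F n).exists_pos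
    have hε : 0 < min ε₀ ε₁ := lt_min hε₀ hε₁
    obtain ⟨R₀, hR₀⟩ := hf.exists_small_large_on_frontier hε
    obtain ⟨k, hk⟩ := exists_nat_ge R₀
    have hrk : R₀ ≤ r k := by linarith [hr_ge k]
    obtain ⟨⟨x, hx, hxε⟩, y, hy, hyε⟩ :=
      hR₀ (r k) hrk _ (F k).isOpen_inner (F k).zero_mem_inner (F k).inner_subset
    have hpre : IsPreconnected (f '' frontier (W (r k))) := by
      refine (F k).isPreconnected_frontier_inner.image f (hf.differentiableOn.continuousOn.mono ?_)
      exact ((F k).frontier_inner_subset.trans (hDX _ (hr1 k))).trans hX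
    refine ⟨k, fun m hm => ?_⟩
    rcases hm with rfl | rfl
    · exact (F 0).inter_frontier_nonempty (hr1 0) hpre
        ⟨f x, mem_image_of_mem f hx, (h₀ _ hε (min_le_left _ _)).1 _ hxε⟩
        ⟨f y, mem_image_of_mem f hy, (h₀ _ hε (min_le_left _ _)).2 _ hyε⟩
    · exact (F m).inter_frontier_nonempty (hr1 m) hpre
        ⟨f x, mem_image_of_mem f hx, (h₁ _ hε (min_le_right _ _)).1 _ hxε⟩
        ⟨f y, mem_image_of_mem f hy, (h₁ _ hε (min_le_right _ _)).2 _ hyε⟩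
  choose k hk using hcross
  -- The image curve joins the two boundaries of the `n`-th domain, making `T n` connected, and also
  -- crosses those of the `0`-th, so every `T n` meets `T 0`.
  let T : ℕ → Set ℂ := fun n =>
    frontier (W (r n)) ∪ f '' frontier (W (r (k n))) ∪ frontier (V (r n))
  have hWX : ∀ n, frontier (W (r n)) ⊆ X := fun n =>
    (F n).frontier_inner_subset.trans (hDX _ (hr1 n))
  have hVX : ∀ n, frontier (V (r n)) ⊆ X := fun n =>
    (F n).frontier_outer_subset.trans (hDX _ (hr1 n))
  have hTX : ∀ n, T n ⊆ X := fun n =>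
    union_subset (union_subset (hWX n) ((hinv.mono_left (hWX _)).image_subset)) (hVX n)
  have hTpre : ∀ n, IsPreconnected (T n) := by
    intro n
    obtain ⟨⟨x, hxf, hxW⟩, y, hyf, hyV⟩ := hk n n (Or.inr rfl)
    have hpre : IsPreconnected (f '' frontier (W (r (k n)))) :=
      (F (k n)).isPreconnected_frontier_inner.image f
        (hf.differentiableOn.continuousOn.mono ((hWX _).trans hX))
    exact ((F n).isPreconnected_frontier_inner.union x hxW hxf hpre).union y (Or.inr hyf) hyV
      (F n).isPreconnected_frontier_outer
  have hT0 : ∀ n, (T n ∩ T 0).Nonempty := by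
    intro n
    obtain ⟨⟨x, hxf, hxW⟩, -⟩ := hk n 0 (Or.inl rfl)
    exact ⟨x, Or.inl (Or.inr hxf), Or.inl (Or.inl hxW)⟩
  refine ⟨⋃ n, T n, iUnion_subset hTX, (iUnion_subset hTX).trans hX, ?_, fun n => G (r n),
    fun n => ⟨(F n).isDomain, (F n).isBounded⟩, fun n => ⟨(F n).isDoublyConnected, (F n).separates⟩,
    fun n => ⟨?_, ?_⟩, ?_⟩
  · obtain ⟨x, hx, -⟩ := hT0 0
    refine ⟨⟨x, mem_iUnion.2 ⟨0, hx⟩⟩, isPreconnected_of_forall x fun y hy => ?_⟩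
    obtain ⟨n, hn⟩ := mem_iUnion.1 hy
    obtain ⟨w, hwn, hw0⟩ := hT0 n
    exact ⟨T n ∪ T 0, union_subset (subset_iUnion T n) (subset_iUnion T 0), Or.inr hx, Or.inl hn,
      (hTpre n).union w hwn hw0 (hTpre 0)⟩
  · refine (hnxG (r n) (hr1 n)).trans ?_
    rw [← hr_succ]
    exact (F (n + 1)).subset_domain
  · refine (F n).frontier_subset.trans (Subset.trans ?_ (subset_iUnion T n))
    exact union_subset_union_left _ subset_union_left
  · refine Subset.antisymm (iUnion_subset fun n => ?_) fun z hz => ?_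
    · exact (hnxG (r n) (hr1 n)).trans (closedAnnulus_subset_Cstar (by
        linarith [hnx (r n) (hr1 n), hr1 n]))
    · obtain ⟨R, hR, hzR⟩ := exists_mem_closedAnnulus hz
      obtain ⟨n, hn⟩ := exists_nat_ge R
      refine mem_iUnion.2 ⟨n, (F n).subset_domain (closedAnnulus_mono (by linarith) ?_ hzR)⟩
      linarith [hr_ge n]

/-- A compactly contained open subset of the punctured plane has the same boundary in the sphere
as in the plane. -/
theorem separates_of_isBoundedInCstar {X G : Set ℂ} {z : ℂ} (hG : IsOpen G) (hz : z ∈ G)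
    (hb : IsBoundedInCstar G) (hX : frontier G ⊆ X) :
    Separates (toSphere X) {(z : Sphere)} zeroInfty := by
  have ho := isOpen_toSphere hG
  refine ⟨toSphere G, ho, singleton_subset_iff.2 (coe_mem_toSphere.2 hz), hb, fun x hx => ?_⟩
  induction x using OnePoint.rec with
  | infty => exact absurd (Or.inr rfl) (disjoint_left.1 hb (frontier_subset_closure hx))
  | coe w =>
    refine coe_mem_toSphere.2 (hX ?_)
    have h1 := OnePoint.isOpenEmbedding_coe.isOpenMap.preimage_frontier_eq_frontier_preimage
      OnePoint.continuous_coe (toSphere G)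
    rw [toSphere, OnePoint.coe_injective.preimage_image] at h1
    rw [← h1]
    exact hx

theorem exists_open_of_separates {X : Set ℂ} {z : ℂ}
    (h : Separates (toSphere X) {(z : Sphere)} zeroInfty) :
    ∃ U : Set ℂ, IsOpen U ∧ z ∈ U ∧ IsCompact (closure U) ∧ closure U ⊆ Cstar ∧
      frontier U ⊆ X := by
  obtain ⟨U, hU, hzU, hdisj, hUX⟩ := h
  have hcl : closure ((fun w : ℂ => (w : Sphere)) ⁻¹' U) ⊆
      (fun w : ℂ => (w : Sphere)) ⁻¹' closure U :=
    OnePoint.continuous_coe.closure_preimage_subset U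
  refine ⟨(fun w : ℂ => (w : Sphere)) ⁻¹' U, hU.preimage OnePoint.continuous_coe,
    hzU rfl, ?_, fun w hw h0 => ?_, fun w hw => ?_⟩
  · refine Metric.isCompact_of_isClosed_isBounded isClosed_closure ?_
    rw [Bornology.isBounded_def]
    have h1 : (closure U)ᶜ ∈ 𝓝 (OnePoint.infty : Sphere) := isClosed_closure.isOpen_compl.mem_nhds
      fun h => disjoint_left.1 hdisj h (Or.inr rfl)
    filter_upwards [tendsto_coe_sphere_cobounded h1] with w hw hw'
    exact hw (hcl hw')
  · rw [mem_singleton_iff] at h0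
    exact disjoint_left.1 hdisj (hcl hw) (Or.inl (by rw [h0]))
  · exact coe_mem_toSphere.1 (hUX (OnePoint.continuous_coe.frontier_preimage_subset U hw))

end SpidersWeb

/-! ### The equivalence -/

theorem mainTheorem3 (f : ℂ → ℂ) (hf : IsTranscendentalSelfMapCstar f)
    (X : Set ℂ) (hX : X ⊆ Cstar) (hinv : MapsTo f X X) :
    (∃ E : Set ℂ, E ⊆ X ∧ IsCstarSpidersWeb E) ↔
      ∃ z ∈ juliaSet f, Separates (toSphere X) {(z : Sphere)} zeroInfty := by
  constructor
  · rintro ⟨E, hEX, -, -, G, hG, -, hGE, hGu⟩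
    obtain ⟨z, hz⟩ := hf.juliaSet_nonempty
    obtain ⟨n, hn⟩ := mem_iUnion.1 (hGu.symm ▸ hz.1 : z ∈ ⋃ n, G n)
    exact ⟨z, hz, separates_of_isBoundedInCstar (hG n).1.1 hn (hG n).2 ((hGE n).2.trans hEX)⟩
  · rintro ⟨z, hz, hsep⟩
    obtain ⟨U, hU, hzU, hUc, hUC, hUX⟩ := exists_open_of_separates hsep
    refine exists_isCstarSpidersWeb_subset hf hX hinv fun R hR => ?_
    obtain ⟨D, hDo, hDc, hRD, hcomp, hDC, hDX⟩ :=
      hf.exists_domain_frontier_subset hinv hz hU hzU hUc hUC hUX hR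
    obtain ⟨W, V, G, h⟩ := exists_isAnnularFilling hR hDo hDc hRD hcomp hDC
    exact ⟨D, W, V, G, hDX, h⟩
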